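/- For a finite simple graph $\Gamma$ with distinct vertex degrees $k_1>\dots>k_r$, where exactly $n_i$ vertices have degree $k_i$, the valency-array of $\Gamma$ is $(n_1,\dots,n_r;k_1,\dots,k_r)$; the spectrum of $\Gamma$ is the multiset of eigenvalues of its adjacency matrix, where $[\theta]^m$ denotes the eigenvalue $\theta$ with multiplicity $m$. Up to isomorphism, there are exactly two finite simple graphs with valency-array $(18,9,9;24,14,8)$ and spectrum $\{[20]^1,[2]^{17},[-3]^{18}\}$. -/

import Mathlib

open Classical in
/-- The distinct valencies `k₁ > ⋯ > k_r` of a finite graph, in decreasing order. -/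
noncomputable def SimpleGraph.valencies {V : Type*} [Fintype V] (G : SimpleGraph V) : List ℕ :=
  (Finset.univ.image fun v => G.degree v).sort (· ≥ ·)

open Classical in
/-- The valency-array `(n₁, …, n_r; k₁, …, k_r)` of a finite graph: `k₁ > ⋯ > k_r` are its distinct
valencies and `n_i` is the number of vertices of valency `k_i`. -/
noncomputable def SimpleGraph.valencyArray {V : Type*} [Fintype V] (G : SimpleGraph V) :
    List ℕ × List ℕ :=
  (G.valencies.map fun k => (Finset.univ.filter fun v => G.degree v = k).card, G.valencies)

open Classical in
/-- The spectrum of a finite graph: the multiset of eigenvalues of its real adjacency matrix,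
counted with multiplicity (the matrix is symmetric, so all roots of its characteristic polynomial
are real and algebraic and geometric multiplicities agree). -/
noncomputable def SimpleGraph.adjSpectrum {V : Type*} [Fintype V] (G : SimpleGraph V) :
    Multiset ℝ :=
  (G.adjMatrix ℝ).charpoly.roots

/-- The graph has valency-array `(18,9,9; 24,14,8)` and spectrum `{[20]¹, [2]¹⁷, [-3]¹⁸}`. -/
def SimpleGraph.HasPrescribedArrayAndSpectrum {V : Type*} [Fintype V] (G : SimpleGraph V) : Prop :=
  G.valencyArray = ([18, 9, 9], [24, 14, 8]) ∧
    G.adjSpectrum =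
      Multiset.replicate 1 20 + Multiset.replicate 17 2 + Multiset.replicate 18 (-3)

/-! The polynomial (θ - 2)(θ + 3) vanishes at 2 and -3 and equals 414 at 20, so the adjacency matrix
A satisfies A² + A = 6 + uuᵀ with u an eigenvector for 20. On the diagonal this says d = 6 + u², so
u is √2 times ±3, ±2, ±1 at the degrees 24, 14, 8. The entries of A² + A are nonnegative, so the
signs agree: A² + A = 6 + 2ααᵀ and Aα = 20α with α = 3, 2, 1. Conversely, these integral identities
and the traces give back the spectrum (`roots_of_rank_one`); the two explicit graphs are checked in
this way.

Counting with these identities (`isConfig`) shows that no edge joins degrees 14 and 8, that each of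
these two classes induces a 2-regular graph, and that the complement κ of the graph on the 18
vertices of degree 24 is 2-regular. Call those 18 vertices points. A vertex of degree 8 gives the
block of its six neighbours among the points, a vertex of degree 14 the block of its six
non-neighbours. The two resulting halves obey the same equations: each point is on three blocks of
either half, and the blocks through the two κ-neighbours of a point x are, with multiplicity, the
neighbours of the blocks through x.

A variance argument (`three_mul_sum_closed`) shows that the components of each block graph have
sizes divisible by 3, so its cycle type is 3+3+3, 6+3 or 9. A point becomes a pair of nine-digit
masks, and the masks of a point and of one κ-neighbour determine those of the other κ-neighbour.
This rule, with the bounds on how far two points agree, forces both halves to have the same type,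
3+3+3 or 6+3 (`IsMasked.types`).

In either case κ contains a triangle, which automorphisms of the block graphs bring into standard
position. A finite search for the other fifteen points (`search_sound`, `results_expected`) leaves
one graph for each type. The graphs differ because only for 3+3+3 do all vertices of degree 8 lie in
triangles of such vertices. -/

/-! ### Spectrum and rank-one quadratic equation -/

open Matrix in
/-- A real symmetric matrix whose spectrum is `{[20]¹, [2]¹⁷, [-3]¹⁸}` satisfies a quadratic
equation up to a matrix of rank one, given by an eigenvector for `20`. -/
theorem Matrix.IsHermitian.exists_rank_one_of_roots {V : Type*} [Fintype V] [DecidableEq V]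
    {A : Matrix V V ℝ} (hA : A.IsHermitian)
    (h : A.charpoly.roots =
      Multiset.replicate 1 20 + Multiset.replicate 17 2 + Multiset.replicate 18 (-3)) :
    ∃ u : V → ℝ, (∀ i j, (A * A + A) i j = (if i = j then 6 else 0) + u i * u j) ∧
      A *ᵥ u = (20 : ℝ) • u := by
  have hroots := hA.roots_charpoly_eq_eigenvalues
  rw [h] at hroots
  set lam := hA.eigenvalues with hlam
  have hmap : Multiset.map lam Finset.univ.val =
      Multiset.replicate 1 20 + Multiset.replicate 17 2 + Multiset.replicate 18 (-3) := by
    rw [hroots]; rfl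
  have hval : ∀ i, lam i = 20 ∨ lam i = 2 ∨ lam i = -3 := by
    intro i
    have : lam i ∈ Multiset.map lam Finset.univ.val :=
      Multiset.mem_map_of_mem _ (Finset.mem_univ i)
    rw [hmap] at this
    simp only [Multiset.mem_add, Multiset.mem_replicate] at this
    tauto
  have hcount : (Finset.univ.filter fun i => (20 : ℝ) = lam i).card = 1 := by
    have h1 := congrArg (Multiset.count (20 : ℝ)) hmap
    rw [Multiset.count_map] at h1
    simp only [Multiset.count_add, Multiset.count_replicate] at h1
    norm_num at h1
    exact h1
  obtain ⟨i₀, hi₀⟩ := Finset.card_eq_one.1 hcount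
  have hi₀' : ∀ i, lam i = 20 ↔ i = i₀ := by
    intro i
    have : i ∈ Finset.univ.filter (fun i => (20 : ℝ) = lam i) ↔ i ∈ ({i₀} : Finset V) := by
      rw [hi₀]
    simpa [eq_comm] using this
  set U : Matrix V V ℝ := (hA.eigenvectorUnitary : Matrix V V ℝ) with hU
  have hUU : U * star U = 1 := Unitary.coe_mul_star_self hA.eigenvectorUnitary
  have hUU' : star U * U = 1 := Unitary.coe_star_mul_self hA.eigenvectorUnitary
  have hspec : A = U * diagonal lam * star U := by
    have := hA.spectral_theorem
    rw [Unitary.conjStarAlgAut_apply] at this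
    exact this
  have hsq : A * A = U * diagonal (fun i => lam i * lam i) * star U := by
    rw [hspec, ← diagonal_mul_diagonal]
    simp only [Matrix.mul_assoc]
    rw [← Matrix.mul_assoc (star U) U, hUU', Matrix.one_mul]
  have hpoly : A * A + A - (6 : ℝ) • 1 =
      U * diagonal (fun i => lam i * lam i + lam i - 6) * star U := by
    have h6 : (6 : ℝ) • (1 : Matrix V V ℝ) = U * diagonal (fun _ => (6 : ℝ)) * star U := by
      have : (diagonal fun _ : V => (6 : ℝ)) = (6 : ℝ) • 1 := by
        ext i j; simp [diagonal_apply, one_apply]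
      rw [this, Matrix.mul_smul, Matrix.mul_one, Matrix.smul_mul, hUU]
    have h1 : A * A + A - (6 : ℝ) • 1 = U * diagonal (fun i => lam i * lam i) * star U +
        U * diagonal lam * star U - U * diagonal (fun _ => (6 : ℝ)) * star U := by
      rw [← hspec, ← hsq, ← h6]
    rw [h1, ← Matrix.add_mul, ← Matrix.sub_mul, ← Matrix.mul_add, ← Matrix.mul_sub,
      diagonal_add, diagonal_sub]
  -- The value of θ² + θ - 6 at θ = 20 is 414; it vanishes at 2 and -3, so only the column of `i₀`
  -- survives.
  refine ⟨fun i => √414 * U i i₀, fun i j => ?_, ?_⟩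
  · have he := congrFun (congrFun hpoly i) j
    have hs : √414 * √414 = (414 : ℝ) := Real.mul_self_sqrt (by norm_num)
    rw [Matrix.mul_apply, Finset.sum_eq_single i₀] at he
    · rw [mul_diagonal, (hi₀' i₀).2 rfl, Matrix.star_apply, star_trivial, Matrix.sub_apply,
        Matrix.smul_apply, Matrix.one_apply] at he
      split_ifs at he ⊢ with hij
      · simp only [smul_eq_mul] at he
        linear_combination he - U i i₀ * U j i₀ * hs
      · simp only [smul_eq_mul] at he
        linear_combination he - U i i₀ * U j i₀ * hs
    · intro k _ hk
      rw [mul_diagonal]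
      rcases hval k with h1 | h1 | h1
      · exact absurd ((hi₀' k).1 h1) hk
      · rw [h1]; norm_num
      · rw [h1]; norm_num
    · simp
  · have h20 := hA.mulVec_eigenvectorBasis i₀
    have hcol : (fun i => √414 * U i i₀) = √414 • ⇑(hA.eigenvectorBasis i₀) := by
      ext i; simp [hU, Matrix.IsHermitian.eigenvectorUnitary_apply]
    rw [hcol, Matrix.mulVec_smul, h20, ← hlam, (hi₀' i₀).2 rfl, smul_comm]

open Matrix in
/-- A real symmetric matrix with `A² + A = 6 + 2ααᵀ` and `Aα = 20α` has all its eigenvalues in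
`{20, 2, -3}`; the multiplicities follow from the traces of `1`, `A` and `A²`. -/
theorem Matrix.IsHermitian.roots_of_rank_one {V : Type*} [Fintype V] [DecidableEq V]
    {A : Matrix V V ℝ} (hA : A.IsHermitian) (u : V → ℝ)
    (hquad : ∀ i j, (A * A + A) i j = (if i = j then 6 else 0) + 2 * (u i * u j))
    (hu : A *ᵥ u = (20 : ℝ) • u) (hcard : Fintype.card V = 36)
    (htr : A.trace = 0) (htr2 : (A * A).trace = 630) :
    A.charpoly.roots =
      Multiset.replicate 1 20 + Multiset.replicate 17 2 + Multiset.replicate 18 (-3) := by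
  set lam := hA.eigenvalues with hlam
  have hval : ∀ i, lam i = 20 ∨ lam i = 2 ∨ lam i = -3 := by
    intro i
    set v : V → ℝ := ⇑(hA.eigenvectorBasis i) with hv
    have hAv : A *ᵥ v = lam i • v := hA.mulVec_eigenvectorBasis i
    have hv0 : v ≠ 0 := by
      intro h0
      apply hA.eigenvectorBasis.toBasis.ne_zero i
      ext j
      simpa using congrFun h0 j
    -- By symmetry of A, an eigenvector for a value other than 20 is orthogonal to `u`. The rank-one
    -- term then kills it, leaving θ² + θ = 6.
    have horth : (20 - lam i) * (u ⬝ᵥ v) = 0 := by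
      have h1 : u ⬝ᵥ (A *ᵥ v) = (A *ᵥ u) ⬝ᵥ v := by
        have hAt : Aᵀ = A := by
          have := hA.eq; rwa [conjTranspose_eq_transpose_of_trivial] at this
        rw [dotProduct_mulVec, ← mulVec_transpose, hAt]
      rw [hAv, hu, dotProduct_smul, smul_dotProduct, smul_eq_mul, smul_eq_mul] at h1
      linear_combination -h1
    rcases mul_eq_zero.1 horth with h1 | h1
    · left; linarith
    · right
      have h2 : (A * A + A) *ᵥ v = (lam i * lam i + lam i) • v := by
        rw [Matrix.add_mulVec, ← Matrix.mulVec_mulVec, hAv, Matrix.mulVec_smul, hAv, smul_smul,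
          add_smul]
      have h3 : (A * A + A) *ᵥ v = (6 : ℝ) • v := by
        ext j
        have : ∀ k, (A * A + A) j k * v k =
            (if j = k then 6 * v k else 0) + 2 * u j * (u k * v k) := by
          intro k; rw [hquad]; split_ifs <;> ring
        simp only [Matrix.mulVec, dotProduct, this, Finset.sum_add_distrib, Finset.sum_ite_eq,
          Finset.mem_univ, if_true, ← Finset.mul_sum]
        have h4 : ∑ k, u k * v k = 0 := h1
        rw [h4]; simp
      obtain ⟨j, hj⟩ := Function.ne_iff.1 hv0
      have h5 := congrFun (h2.symm.trans h3) j
      simp only [Pi.smul_apply, smul_eq_mul] at h5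
      have h6 : lam i * lam i + lam i = 6 := mul_right_cancel₀ hj h5
      have h7 : (lam i - 2) * (lam i + 3) = 0 := by linear_combination h6
      rcases mul_eq_zero.1 h7 with h | h
      · left; linarith
      · right; linarith
  set a := (Finset.univ.filter fun i => lam i = 20).card with ha
  set b := (Finset.univ.filter fun i => lam i = 2).card with hb
  set c := (Finset.univ.filter fun i => lam i = -3).card with hc
  have hsum : ∀ f : ℝ → ℝ, ∑ i, f (lam i) = a * f 20 + b * f 2 + c * f (-3) := by
    intro f
    have : ∀ i, f (lam i) = (if lam i = 20 then f 20 else 0) + (if lam i = 2 then f 2 else 0) +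
        (if lam i = -3 then f (-3) else 0) := by
      intro i
      rcases hval i with h | h | h <;> rw [h] <;> norm_num
    rw [Finset.sum_congr rfl fun i _ => this i, Finset.sum_add_distrib, Finset.sum_add_distrib,
      ← Finset.sum_filter, ← Finset.sum_filter, ← Finset.sum_filter]
    simp [a, b, c]
  have e0 : (a : ℝ) + b + c = 36 := by
    have := hsum fun _ => 1
    simp only [Finset.sum_const, Finset.card_univ, hcard] at this
    norm_num at this; linarith
  have e1 : 20 * (a : ℝ) + 2 * b - 3 * c = 0 := by
    have h1 := hsum fun x => x
    have h2 : A.trace = ∑ i, lam i := by simpa using hA.trace_eq_sum_eigenvalues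
    rw [← h2, htr] at h1; linarith
  have e2 : 400 * (a : ℝ) + 4 * b + 9 * c = 630 := by
    have h1 := hsum fun x => x * x
    have h2 : (A * A).trace = ∑ i, lam i * lam i := by
      have hUU' := Unitary.coe_star_mul_self hA.eigenvectorUnitary
      have hspec := hA.spectral_theorem
      rw [Unitary.conjStarAlgAut_apply] at hspec
      rw [hspec]
      simp only [Matrix.mul_assoc]
      rw [Matrix.trace_mul_comm]
      simp only [Matrix.mul_assoc]
      rw [hUU', Matrix.mul_one, ← Matrix.mul_assoc (star _) _ (diagonal _), hUU', Matrix.one_mul,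
        diagonal_mul_diagonal, trace_diagonal]
      rfl
    rw [← h2, htr2] at h1; linarith
  have ea : a = 1 := by
    have : (a : ℝ) = 1 := by linarith
    exact_mod_cast this
  have eb : b = 17 := by
    have : (b : ℝ) = 17 := by linarith
    exact_mod_cast this
  have ec : c = 18 := by
    have : (c : ℝ) = 18 := by linarith
    exact_mod_cast this
  have hroots : A.charpoly.roots = Multiset.map lam Finset.univ.val :=
    hA.roots_charpoly_eq_eigenvalues
  rw [hroots]
  ext x
  simp only [Multiset.count_add, Multiset.count_replicate, Multiset.count_map]
  have hc' : ∀ y : ℝ, (Multiset.filter (fun i => y = lam i) Finset.univ.val).card =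
      (Finset.univ.filter fun i => lam i = y).card := by
    intro y
    rw [Finset.card_def, Finset.filter_val]
    congr 1
    exact Multiset.filter_congr fun i _ => eq_comm
  rw [hc']
  by_cases h20 : x = 20
  · subst h20; rw [← ha, ea]; norm_num
  by_cases h2 : x = 2
  · subst h2; rw [← hb, eb]; norm_num
  by_cases h3 : x = -3
  · subst h3; rw [← hc, ec]; norm_num
  rw [if_neg (Ne.symm h20), if_neg (Ne.symm h2), if_neg (Ne.symm h3), Finset.card_eq_zero,
    Finset.filter_eq_empty_iff]
  intro i _ h
  rcases hval i with h' | h' | h' <;> simp_all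

/-! ### Integral form of the equations -/

/-- The indicator of adjacency, as an integer. -/
noncomputable def SimpleGraph.ind {V : Type*} (G : SimpleGraph V) (u v : V) : ℤ :=
  open Classical in if G.Adj u v then 1 else 0

theorem SimpleGraph.ind_zero_or_one {V : Type*} (G : SimpleGraph V) (u v : V) :
    G.ind u v = 0 ∨ G.ind u v = 1 := by
  unfold SimpleGraph.ind; split_ifs <;> simp

theorem SimpleGraph.ind_comm {V : Type*} (G : SimpleGraph V) (u v : V) :
    G.ind u v = G.ind v u := by
  unfold SimpleGraph.ind
  by_cases h : G.Adj u v
  · rw [if_pos h, if_pos h.symm]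
  · rw [if_neg h, if_neg fun h' => h h'.symm]

theorem SimpleGraph.ind_self {V : Type*} (G : SimpleGraph V) (u : V) : G.ind u u = 0 := by
  unfold SimpleGraph.ind; simp

theorem SimpleGraph.ind_eq_one {V : Type*} (G : SimpleGraph V) (u v : V) :
    G.ind u v = 1 ↔ G.Adj u v := by
  unfold SimpleGraph.ind; split_ifs <;> simp [*]

/-- The Perron weight (up to a factor `√2`) of a vertex of degree `d`. -/
def degreeWeight (d : ℕ) : ℤ := if d = 24 then 3 else if d = 14 then 2 else 1

section
open Classical

theorem SimpleGraph.HasPrescribedArrayAndSpectrum.degree_eq {V : Type*} [Fintype V]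
    {G : SimpleGraph V} (h : G.HasPrescribedArrayAndSpectrum) (v : V) :
    G.degree v = 24 ∨ G.degree v = 14 ∨ G.degree v = 8 := by
  have h1 : G.valencies = [24, 14, 8] := congrArg Prod.snd h.1
  have h2 : G.degree v ∈ G.valencies := by
    unfold SimpleGraph.valencies
    rw [Finset.mem_sort]
    exact Finset.mem_image_of_mem _ (Finset.mem_univ v)
  rw [h1] at h2
  simpa using h2

theorem SimpleGraph.HasPrescribedArrayAndSpectrum.card_degree {V : Type*} [Fintype V]
    {G : SimpleGraph V} (h : G.HasPrescribedArrayAndSpectrum) :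
    Fintype.card {v // G.degree v = 24} = 18 ∧ Fintype.card {v // G.degree v = 14} = 9 ∧
      Fintype.card {v // G.degree v = 8} = 9 := by
  have h1 : G.valencies = [24, 14, 8] := congrArg Prod.snd h.1
  have h2 := congrArg Prod.fst h.1
  simp only [SimpleGraph.valencyArray, h1, List.map_cons, List.map_nil, List.cons.injEq,
    and_true] at h2
  simp only [Fintype.card_subtype]
  exact h2

/-- The diagonal of A² + A determines the squares of the entries of the rank-one vector, and
nonnegativity of all entries of A² + A makes the products of two entries nonnegative. So every
product is determined, and it is an integer. -/
theorem SimpleGraph.HasPrescribedArrayAndSpectrum.quadratic {V : Type*} [Fintype V]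
    {G : SimpleGraph V} (h : G.HasPrescribedArrayAndSpectrum) :
    (∀ u v, ∑ w, G.ind u w * G.ind w v + G.ind u v = (if u = v then 6 else 0) +
      2 * (degreeWeight (G.degree u) * degreeWeight (G.degree v))) ∧
    ∀ u, ∑ w, G.ind u w * degreeWeight (G.degree w) = 20 * degreeWeight (G.degree u) := by
  have hH : (G.adjMatrix ℝ).IsHermitian := by
    unfold Matrix.IsHermitian
    rw [Matrix.conjTranspose_eq_transpose_of_trivial]
    exact G.transpose_adjMatrix (α := ℝ)
  obtain ⟨u, hu, hA⟩ := hH.exists_rank_one_of_roots h.2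
  have hent : ∀ i j, G.adjMatrix ℝ i j = (G.ind i j : ℝ) := by
    intro i j
    rw [SimpleGraph.adjMatrix_apply]
    unfold SimpleGraph.ind
    split_ifs <;> simp
  have hq : ∀ i j, ((∑ w, G.ind i w * G.ind w j + G.ind i j : ℤ) : ℝ) =
      (if i = j then 6 else 0) + u i * u j := by
    intro i j
    rw [← hu i j]
    simp only [Matrix.add_apply, Matrix.mul_apply, hent]
    push_cast
    rfl
  set α : V → ℤ := fun v => degreeWeight (G.degree v) with hα
  have hαpos : ∀ v, 0 < α v := by
    intro v; simp only [hα, degreeWeight]; split_ifs <;> norm_num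
  have hd : ∀ v, (G.degree v : ℤ) = 6 + 2 * (α v * α v) := by
    intro v
    rcases h.degree_eq v with h | h | h <;> simp [hα, degreeWeight, h]
  have hdiag : ∀ v, ∑ w, G.ind v w * G.ind w v + G.ind v v = (G.degree v : ℤ) := by
    intro v
    have : ∀ w, G.ind v w * G.ind w v = if G.Adj v w then 1 else 0 := by
      intro w; rw [G.ind_comm w v]; unfold SimpleGraph.ind; split_ifs <;> simp
    rw [G.ind_self, Finset.sum_congr rfl fun w _ => this w, ← Finset.sum_filter,
      Finset.sum_const, ← SimpleGraph.card_neighborFinset_eq_degree,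
      SimpleGraph.neighborFinset_eq_filter]
    simp
  have husq : ∀ v, u v * u v = 2 * ((α v : ℝ) * α v) := by
    intro v
    have h1 := hq v v
    rw [hdiag, hd, if_pos rfl] at h1
    push_cast at h1; linarith
  have hprod : ∀ i j, u i * u j = 2 * ((α i : ℝ) * α j) := by
    intro i j
    by_cases hij : i = j
    · subst hij; exact husq i
    · have h1 := hq i j
      rw [if_neg hij, zero_add] at h1
      have h0 : 0 ≤ u i * u j := by
        rw [← h1]
        have : (0 : ℤ) ≤ ∑ w, G.ind i w * G.ind w j + G.ind i j := by
          have hn : ∀ a b, 0 ≤ G.ind a b := by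
            intro a b; rcases G.ind_zero_or_one a b with h | h <;> rw [h]; norm_num
          exact add_nonneg (Finset.sum_nonneg fun w _ => mul_nonneg (hn _ _) (hn _ _)) (hn _ _)
        exact_mod_cast this
      have h2 : (0 : ℝ) < α i := by exact_mod_cast hαpos i
      have h3 : (0 : ℝ) < α j := by exact_mod_cast hαpos j
      have h4 : (u i * u j) ^ 2 = (2 * ((α i : ℝ) * α j)) ^ 2 := by
        have : (u i * u j) ^ 2 = (u i * u i) * (u j * u j) := by ring
        rw [this, husq, husq]; ring
      exact (sq_eq_sq₀ h0 (by positivity)).1 h4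
  refine ⟨fun i j => ?_, fun i => ?_⟩
  · have h1 := hq i j
    rw [hprod] at h1
    split_ifs at h1 ⊢ <;> exact_mod_cast h1
  · have h1 : ∑ w, (G.ind i w : ℝ) * u w = 20 * u i := by
      have := congrFun hA i
      simpa only [Matrix.mulVec, dotProduct, hent, Pi.smul_apply, smul_eq_mul] using this
    -- Multiplying by `u i` leaves only products of two entries of `u`, which are known.
    have h2 : ∑ w, (G.ind i w : ℝ) * (u w * u i) = 20 * (u i * u i) := by
      rw [← mul_assoc, ← h1, Finset.sum_mul]
      exact Finset.sum_congr rfl fun w _ => by ring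
    have h3 : (2 * (α i : ℝ)) * ∑ w, (G.ind i w : ℝ) * α w = (2 * (α i : ℝ)) * (20 * α i) := by
      rw [Finset.mul_sum]
      calc _ = ∑ w, (G.ind i w : ℝ) * (u w * u i) :=
            Finset.sum_congr rfl fun w _ => by rw [hprod]; ring
        _ = _ := by rw [h2, husq]; ring
    have h4 : (2 * (α i : ℝ)) ≠ 0 := by
      have : (α i : ℝ) ≠ 0 := by exact_mod_cast (hαpos i).ne'
      simpa using this
    have h5 := mul_left_cancel₀ h4 h3
    exact_mod_cast h5

end

/-- The vertex set, split according to the three valencies `24`, `14` and `8`. -/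
abbrev Vertex : Type := Fin 18 ⊕ Fin 9 ⊕ Fin 9

/-- The Perron weights on `Vertex`. -/
def Vertex.weight : Vertex → ℤ
  | .inl _ => 3
  | .inr (.inl _) => 2
  | .inr (.inr _) => 1

/-- The quadratic equation and the eigenvector equation for a graph on `Vertex`. -/
structure SimpleGraph.IsQuadratic (H : SimpleGraph Vertex) : Prop where
  quad : ∀ u v, ∑ w, H.ind u w * H.ind w v + H.ind u v =
    (if u = v then 6 else 0) + 2 * (u.weight * v.weight)
  eig : ∀ u, ∑ w, H.ind u w * w.weight = 20 * u.weight

theorem SimpleGraph.HasPrescribedArrayAndSpectrum.exists_isQuadratic {V : Type*} [Fintype V]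
    {G : SimpleGraph V} (h : G.HasPrescribedArrayAndSpectrum) :
    ∃ H : SimpleGraph Vertex, H.IsQuadratic ∧ Nonempty (G ≃g H) := by
  classical
  obtain ⟨h24, h14, h8⟩ := h.card_degree
  let e₁ := Fintype.equivFinOfCardEq h24
  let e₂ := Fintype.equivFinOfCardEq h14
  let e₃ := Fintype.equivFinOfCardEq h8
  let f : Vertex → V := Sum.elim (fun i => (e₁.symm i).1)
    (Sum.elim (fun i => (e₂.symm i).1) (fun i => (e₃.symm i).1))
  have d₁ : ∀ i, G.degree (f (.inl i)) = 24 := fun i => (e₁.symm i).2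
  have d₂ : ∀ i, G.degree (f (.inr (.inl i))) = 14 := fun i => (e₂.symm i).2
  have d₃ : ∀ i, G.degree (f (.inr (.inr i))) = 8 := fun i => (e₃.symm i).2
  have hinj : Function.Injective f := by
    rintro (i | i | i) (j | j | j) hij
    · exact congrArg _ (e₁.symm.injective (Subtype.ext hij))
    · have := congrArg (fun v => G.degree v) hij; simp only [d₁, d₂] at this; omega
    · have := congrArg (fun v => G.degree v) hij; simp only [d₁, d₃] at this; omega
    · have := congrArg (fun v => G.degree v) hij; simp only [d₁, d₂] at this; omega
    · exact congrArg (Sum.inr ∘ Sum.inl) (e₂.symm.injective (Subtype.ext hij))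
    · have := congrArg (fun v => G.degree v) hij; simp only [d₂, d₃] at this; omega
    · have := congrArg (fun v => G.degree v) hij; simp only [d₁, d₃] at this; omega
    · have := congrArg (fun v => G.degree v) hij; simp only [d₂, d₃] at this; omega
    · exact congrArg (Sum.inr ∘ Sum.inr) (e₃.symm.injective (Subtype.ext hij))
  have hsurj : Function.Surjective f := by
    intro v
    rcases h.degree_eq v with hv | hv | hv
    · exact ⟨.inl (e₁ ⟨v, hv⟩), by simp [f]⟩
    · exact ⟨.inr (.inl (e₂ ⟨v, hv⟩)), by simp [f]⟩
    · exact ⟨.inr (.inr (e₃ ⟨v, hv⟩)), by simp [f]⟩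
  obtain ⟨φ, hw⟩ : ∃ φ : Vertex ≃ V, ∀ u, degreeWeight (G.degree (φ u)) = u.weight := by
    have hbij : Function.Bijective f := ⟨hinj, hsurj⟩
    refine ⟨Equiv.ofBijective f hbij, ?_⟩
    rintro (i | i | i)
    · rw [Equiv.ofBijective_apply, d₁]; rfl
    · rw [Equiv.ofBijective_apply, d₂]; rfl
    · rw [Equiv.ofBijective_apply, d₃]; rfl
  clear_value f
  have hind : ∀ u v, (G.comap φ).ind u v = G.ind (φ u) (φ v) := fun u v => rfl
  obtain ⟨hq, he⟩ := h.quadratic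
  refine ⟨G.comap φ, ⟨fun u v => ?_, fun u => ?_⟩, ⟨(SimpleGraph.Iso.comap φ G).symm⟩⟩
  · have h1 := hq (φ u) (φ v)
    rw [hw, hw, ← Equiv.sum_comp φ] at h1
    simp only [hind]
    rw [h1]
    simp only [EmbeddingLike.apply_eq_iff_eq]
  · have h1 := he (φ u)
    rw [hw, ← Equiv.sum_comp φ] at h1
    simp only [hw] at h1
    simp only [hind]
    exact h1

/-! ### Points, blocks and the two halves -/

/-- One half of the configuration: nine blocks on eighteen points, with a `2`-regular graph `D` on
the blocks and a graph `κ` on the points, compatible with the incidence relation `I`. All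
relations are given by integer indicators. -/
structure IsHalf (κ : Fin 18 → Fin 18 → ℤ) (D : Fin 9 → Fin 9 → ℤ) (I : Fin 9 → Fin 18 → ℤ) :
    Prop where
  graph_zero_or_one : ∀ y z, D y z = 0 ∨ D y z = 1
  graph_self : ∀ y, D y y = 0
  graph_comm : ∀ y z, D y z = D z y
  graph_regular : ∀ y, ∑ z, D y z = 2
  inc_zero_or_one : ∀ y x, I y x = 0 ∨ I y x = 1
  point_degree : ∀ x, ∑ y, I y x = 3
  block_size : ∀ y, ∑ x, I y x = 6
  inter : ∀ y z, ∑ x, I y x * I z x + D y z + ∑ t, D y t * D t z = (if y = z then 6 else 0) + 2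
  wave : ∀ x y, ∑ x', κ x x' * I y x' = ∑ z, D y z * I z x

/-- Two halves on the same eighteen points. -/
structure IsConfig (κ : Fin 18 → Fin 18 → ℤ) (D E : Fin 9 → Fin 9 → ℤ) (I J : Fin 9 → Fin 18 → ℤ) :
    Prop where
  zero_or_one : ∀ x y, κ x y = 0 ∨ κ x y = 1
  self : ∀ x, κ x x = 0
  comm : ∀ x y, κ x y = κ y x
  regular : ∀ x, ∑ y, κ x y = 2
  left : IsHalf κ D I
  right : IsHalf κ E J
  cross : ∀ y z, ∑ x, I y x * J z x = 2
  agree : ∀ x x', ∑ y, I y x * I y x' + ∑ z, J z x * J z x' + κ x x' + ∑ t, κ x t * κ t x' =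
    (if x = x' then 6 else 0) + 2

/-- Non-adjacency among the vertices of degree `24`. -/
noncomputable def SimpleGraph.coind (H : SimpleGraph Vertex) (x y : Fin 18) : ℤ :=
  1 - (if x = y then 1 else 0) - H.ind (.inl x) (.inl y)

namespace SimpleGraph.IsQuadratic

variable {H : SimpleGraph Vertex} (h : H.IsQuadratic)

theorem sum_split {M : Type*} [AddCommMonoid M] (f : Vertex → M) :
    ∑ w, f w = ∑ x, f (.inl x) + (∑ b, f (.inr (.inl b)) + ∑ c, f (.inr (.inr c))) := by
  rw [Fintype.sum_sum_type, Fintype.sum_sum_type]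

include h

theorem degree (u : Vertex) : ∑ w, H.ind u w = 6 + 2 * (u.weight * u.weight) := by
  have h1 := h.quad u u
  rw [if_pos rfl, H.ind_self, add_zero] at h1
  rw [← h1]
  refine Finset.sum_congr rfl fun w _ => ?_
  rw [H.ind_comm w u]
  rcases H.ind_zero_or_one u w with e | e <;> rw [e] <;> norm_num

/-- By the degree and eigenvector equations, a vertex b of degree 14 with a neighbour c of degree 8
has 13 neighbours of degree 24 and none of degree 14, and by parity c has a second neighbour b' of
degree 14. Then b and b' share at least 8 vertices of degree 24 and also c, but the quadratic
equation allows just 2·2·2 = 8 common neighbours. -/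
theorem no_edge (b c : Fin 9) : H.ind (.inr (.inl b)) (.inr (.inr c)) = 0 := by
  have nn : ∀ u v, 0 ≤ H.ind u v ∧ H.ind u v ≤ 1 := by
    intro u v; rcases H.ind_zero_or_one u v with e | e <;> rw [e] <;> norm_num
  have hb : ∀ b c : Fin 9, H.ind (.inr (.inl b)) (.inr (.inr c)) = 1 →
      ∑ x, H.ind (.inr (.inl b)) (.inl x) = 13 ∧
      ∑ b', H.ind (.inr (.inl b)) (.inr (.inl b')) = 0 := by
    intro b c hbc
    have h1 := h.degree (.inr (.inl b))
    have h2 := h.eig (.inr (.inl b))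
    rw [sum_split] at h1 h2
    simp only [Vertex.weight, ← Finset.sum_mul] at h1 h2
    have h3 : 0 ≤ ∑ b', H.ind (.inr (.inl b)) (.inr (.inl b')) :=
      Finset.sum_nonneg fun _ _ => (nn _ _).1
    have h4 : 1 ≤ ∑ c', H.ind (.inr (.inl b)) (.inr (.inr c')) := by
      rw [← hbc]
      exact Finset.single_le_sum (f := fun c' => H.ind (.inr (.inl b)) (.inr (.inr c')))
        (fun _ _ => (nn _ _).1) (Finset.mem_univ c)
    constructor <;> omega
  rcases H.ind_zero_or_one (.inr (.inl b)) (.inr (.inr c)) with e | e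
  · exact e
  exfalso
  obtain ⟨b', hne, hb'⟩ : ∃ b', b' ≠ b ∧ H.ind (.inr (.inr c)) (.inr (.inl b')) = 1 := by
    by_contra hcon
    push Not at hcon
    have h1 := h.degree (.inr (.inr c))
    have h2 := h.eig (.inr (.inr c))
    rw [sum_split] at h1 h2
    simp only [Vertex.weight, ← Finset.sum_mul] at h1 h2
    -- With a single neighbour of degree 14, the two equations would give 2n = 11 for the number n
    -- of neighbours of degree 24.
    have h3 : ∑ b', H.ind (.inr (.inr c)) (.inr (.inl b')) = 1 := by
      rw [Finset.sum_eq_single b]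
      · rw [H.ind_comm, e]
      · intro b' _ hb'
        exact (H.ind_zero_or_one _ _).resolve_right (hcon b' hb')
      · simp
    omega
  rw [H.ind_comm] at hb'
  obtain ⟨s1, t1⟩ := hb b c e
  obtain ⟨s2, t2⟩ := hb b' c hb'
  have hbb : H.ind (.inr (.inl b)) (.inr (.inl b')) = 0 :=
    (Finset.sum_eq_zero_iff_of_nonneg fun _ _ => (nn _ _).1).1 t1 b' (Finset.mem_univ _)
  have hq := h.quad (.inr (.inl b)) (.inr (.inl b'))
  rw [hbb, if_neg (by simpa using hne.symm), sum_split] at hq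
  simp only [Vertex.weight] at hq
  -- Inclusion and exclusion: at least 13 + 13 - 18 = 8 common points.
  have h1 : ∑ x, (H.ind (.inr (.inl b)) (.inl x) + H.ind (.inr (.inl b')) (.inl x) - 1) ≤
      ∑ x, H.ind (.inr (.inl b)) (.inl x) * H.ind (.inl x) (.inr (.inl b')) := by
    refine Finset.sum_le_sum fun x _ => ?_
    rw [H.ind_comm (.inl x)]
    rcases H.ind_zero_or_one (.inr (.inl b)) (.inl x) with e | e <;>
    rcases H.ind_zero_or_one (.inr (.inl b')) (.inl x) with e' | e' <;> rw [e, e'] <;> norm_num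
  rw [Finset.sum_sub_distrib, Finset.sum_add_distrib, s1, s2] at h1
  simp only [Finset.sum_const, Finset.card_univ, Fintype.card_fin] at h1
  have h2 : 0 ≤ ∑ x, H.ind (.inr (.inl b)) (.inr (.inl x)) *
      H.ind (.inr (.inl x)) (.inr (.inl b')) :=
    Finset.sum_nonneg fun _ _ => mul_nonneg (nn _ _).1 (nn _ _).1
  have h3 : 1 ≤ ∑ x, H.ind (.inr (.inl b)) (.inr (.inr x)) *
      H.ind (.inr (.inr x)) (.inr (.inl b')) := by
    have : H.ind (.inr (.inl b)) (.inr (.inr c)) * H.ind (.inr (.inr c)) (.inr (.inl b')) = 1 := by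
      rw [e, H.ind_comm, hb']; norm_num
    rw [← this]
    exact Finset.single_le_sum (f := fun x => H.ind (.inr (.inl b)) (.inr (.inr x)) *
      H.ind (.inr (.inr x)) (.inr (.inl b'))) (fun _ _ => mul_nonneg (nn _ _).1 (nn _ _).1)
      (Finset.mem_univ c)
  norm_num at h1
  omega

theorem sums_b (b : Fin 9) : ∑ x, H.ind (.inr (.inl b)) (.inl x) = 12 ∧
    ∑ b', H.ind (.inr (.inl b)) (.inr (.inl b')) = 2 := by
  have h1 := h.degree (.inr (.inl b))
  have h2 := h.eig (.inr (.inl b))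
  rw [sum_split] at h1 h2
  simp only [Vertex.weight, ← Finset.sum_mul, h.no_edge, Finset.sum_const_zero] at h1 h2
  constructor <;> omega

theorem sums_c (c : Fin 9) : ∑ x, H.ind (.inr (.inr c)) (.inl x) = 6 ∧
    ∑ c', H.ind (.inr (.inr c)) (.inr (.inr c')) = 2 := by
  have h1 := h.degree (.inr (.inr c))
  have h2 := h.eig (.inr (.inr c))
  rw [sum_split] at h1 h2
  simp only [Vertex.weight, ← Finset.sum_mul, H.ind_comm _ (.inr (.inl _)), h.no_edge,
    Finset.sum_const_zero] at h1 h2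
  constructor <;> omega

/-- This is the (x, c) entry of the quadratic equation, written with κ in place of its complement.
The constant 2·3·1 = 6 cancels against the block size 6, so a homogeneous identity κIᵀ = IᵀD
remains. -/
theorem wave_c (x : Fin 18) (c : Fin 9) :
    ∑ x', H.coind x x' * H.ind (.inr (.inr c)) (.inl x') =
      ∑ c', H.ind (.inr (.inr c)) (.inr (.inr c')) * H.ind (.inr (.inr c')) (.inl x) := by
  have hq := h.quad (.inl x) (.inr (.inr c))
  rw [sum_split, if_neg (by simp)] at hq
  simp only [Vertex.weight, h.no_edge, mul_zero, Finset.sum_const_zero] at hq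
  have e1 : ∀ x', H.coind x x' * H.ind (.inr (.inr c)) (.inl x') =
      H.ind (.inr (.inr c)) (.inl x') - (if x = x' then H.ind (.inr (.inr c)) (.inl x') else 0) -
        H.ind (.inl x) (.inl x') * H.ind (.inl x') (.inr (.inr c)) := by
    intro x'
    rw [H.ind_comm (.inl x') (.inr (.inr c))]
    unfold SimpleGraph.coind; split_ifs <;> ring
  have e2 : ∑ c', H.ind (.inr (.inr c)) (.inr (.inr c')) * H.ind (.inr (.inr c')) (.inl x) =
      ∑ c', H.ind (.inl x) (.inr (.inr c')) * H.ind (.inr (.inr c')) (.inr (.inr c)) :=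
    Finset.sum_congr rfl fun c' _ => by
      rw [H.ind_comm (.inr (.inr c)), H.ind_comm (.inl x)]; ring
  rw [Finset.sum_congr rfl fun x' _ => e1 x', Finset.sum_sub_distrib, Finset.sum_sub_distrib,
    (h.sums_c c).1, e2, Finset.sum_ite_eq, if_pos (Finset.mem_univ _)]
  rw [H.ind_comm (.inl x) (.inr (.inr c))] at hq
  linarith

/-- The degree and eigenvector equations leave one parameter: a point of κ-degree k has 5 - k
neighbours of degree 8 and 2 + 2k of degree 14. As the latter number is at most 9, the number r = 5
- k is between 2 and 5 at every point. Summing `wave_c` over c, the values of r at the κ-neighbours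
of x add up to 2r, so 2k ≤ 2r ≤ 5k, which forces k = 2. -/
theorem sums_x (x : Fin 18) : ∑ y, H.coind x y = 2 ∧
    ∑ b, H.ind (.inr (.inl b)) (.inl x) = 6 ∧ ∑ c, H.ind (.inr (.inr c)) (.inl x) = 3 := by
  have key : ∀ x, ∑ y, H.coind x y = 17 - ∑ y, H.ind (.inl x) (.inl y) ∧
      ∑ b, H.ind (.inr (.inl b)) (.inl x) = 36 - 2 * ∑ y, H.ind (.inl x) (.inl y) ∧
      ∑ c, H.ind (.inr (.inr c)) (.inl x) = ∑ y, H.ind (.inl x) (.inl y) - 12 := by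
    intro x
    have h1 := h.degree (.inl x)
    have h2 := h.eig (.inl x)
    rw [sum_split] at h1 h2
    simp only [Vertex.weight, ← Finset.sum_mul] at h1 h2
    have h3 : ∑ y, H.coind x y = 17 - ∑ y, H.ind (.inl x) (.inl y) := by
      unfold SimpleGraph.coind
      rw [Finset.sum_sub_distrib, Finset.sum_sub_distrib]
      simp
    have h4 : ∑ b, H.ind (.inr (.inl b)) (.inl x) = ∑ b, H.ind (.inl x) (.inr (.inl b)) :=
      Finset.sum_congr rfl fun _ _ => H.ind_comm _ _
    have h5 : ∑ c, H.ind (.inr (.inr c)) (.inl x) = ∑ c, H.ind (.inl x) (.inr (.inr c)) :=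
      Finset.sum_congr rfl fun _ _ => H.ind_comm _ _
    refine ⟨h3, ?_, ?_⟩ <;> omega
  have hk : ∀ x y, 0 ≤ H.coind x y := by
    intro x y; unfold SimpleGraph.coind
    by_cases hxy : x = y
    · subst hxy; rw [H.ind_self]; simp
    · rcases H.ind_zero_or_one (.inl x) (.inl y) with e | e <;> rw [e] <;> simp [hxy]
  have hrange : ∀ x, 2 ≤ ∑ c, H.ind (.inr (.inr c)) (.inl x) ∧
      ∑ c, H.ind (.inr (.inr c)) (.inl x) ≤ 5 ∧
      ∑ c, H.ind (.inr (.inr c)) (.inl x) = 5 - ∑ y, H.coind x y := by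
    intro x
    obtain ⟨k1, k2, k3⟩ := key x
    have h1 : ∑ b : Fin 9, H.ind (.inr (.inl b)) (.inl x) ≤ ∑ _b : Fin 9, 1 :=
      Finset.sum_le_sum fun b _ => by
        rcases H.ind_zero_or_one (.inr (.inl b)) (.inl x) with e | e <;> rw [e]; norm_num
    have h2 : 0 ≤ ∑ y, H.coind x y := Finset.sum_nonneg fun _ _ => hk _ _
    simp only [Finset.sum_const, Finset.card_univ, Fintype.card_fin] at h1
    norm_num at h1
    refine ⟨?_, ?_, ?_⟩ <;> omega
  have hw : ∑ y, H.coind x y * ∑ c, H.ind (.inr (.inr c)) (.inl y) =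
      2 * ∑ c, H.ind (.inr (.inr c)) (.inl x) := by
    have h1 : ∑ c, ∑ x', H.coind x x' * H.ind (.inr (.inr c)) (.inl x') =
        ∑ c, ∑ c', H.ind (.inr (.inr c)) (.inr (.inr c')) * H.ind (.inr (.inr c')) (.inl x) :=
      Finset.sum_congr rfl fun c _ => h.wave_c x c
    rw [Finset.sum_comm] at h1
    simp only [Finset.mul_sum]
    rw [h1, Finset.sum_comm]
    refine Finset.sum_congr rfl fun c _ => ?_
    rw [← Finset.sum_mul]
    congr 1
    rw [← (h.sums_c c).2]
    exact Finset.sum_congr rfl fun _ _ => H.ind_comm _ _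
  have lo : (∑ y, H.coind x y) * 2 ≤ ∑ y, H.coind x y * ∑ c, H.ind (.inr (.inr c)) (.inl y) := by
    rw [Finset.sum_mul]
    exact Finset.sum_le_sum fun y _ => mul_le_mul_of_nonneg_left (hrange y).1 (hk _ _)
  have hi : ∑ y, H.coind x y * ∑ c, H.ind (.inr (.inr c)) (.inl y) ≤ (∑ y, H.coind x y) * 5 := by
    rw [Finset.sum_mul]
    exact Finset.sum_le_sum fun y _ => mul_le_mul_of_nonneg_left (hrange y).2.1 (hk _ _)
  obtain ⟨r1, r2, r3⟩ := hrange x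
  obtain ⟨k1, k2, k3⟩ := key x
  rw [hw] at lo hi
  refine ⟨?_, ?_, ?_⟩ <;> omega

theorem wave_b (x : Fin 18) (b : Fin 9) :
    ∑ x', H.coind x x' * (1 - H.ind (.inr (.inl b)) (.inl x')) =
      ∑ b', H.ind (.inr (.inl b)) (.inr (.inl b')) * (1 - H.ind (.inr (.inl b')) (.inl x)) := by
  have hq := h.quad (.inl x) (.inr (.inl b))
  rw [sum_split, if_neg (by simp)] at hq
  simp only [Vertex.weight, H.ind_comm (.inr (.inr _)) (.inr (.inl _)), h.no_edge, mul_zero,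
    Finset.sum_const_zero] at hq
  have e1 : ∀ x', H.coind x x' * (1 - H.ind (.inr (.inl b)) (.inl x')) = H.coind x x' -
      (H.ind (.inr (.inl b)) (.inl x') - (if x = x' then H.ind (.inr (.inl b)) (.inl x') else 0) -
        H.ind (.inl x) (.inl x') * H.ind (.inl x') (.inr (.inl b))) := by
    intro x'
    rw [H.ind_comm (.inl x') (.inr (.inl b))]
    unfold SimpleGraph.coind; split_ifs <;> ring
  have e2 : ∑ b', H.ind (.inr (.inl b)) (.inr (.inl b')) * (1 - H.ind (.inr (.inl b')) (.inl x)) =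
      ∑ b', H.ind (.inr (.inl b)) (.inr (.inl b')) -
      ∑ b', H.ind (.inl x) (.inr (.inl b')) * H.ind (.inr (.inl b')) (.inr (.inl b)) := by
    rw [← Finset.sum_sub_distrib]
    exact Finset.sum_congr rfl fun c' _ => by
      rw [H.ind_comm (.inr (.inl c')) (.inr (.inl b)), H.ind_comm (.inl x)]; ring
  rw [Finset.sum_congr rfl fun x' _ => e1 x', Finset.sum_sub_distrib, Finset.sum_sub_distrib,
    Finset.sum_sub_distrib, (h.sums_b b).1, (h.sums_x x).1, e2, (h.sums_b b).2, Finset.sum_ite_eq,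
    if_pos (Finset.mem_univ _)]
  rw [H.ind_comm (.inl x) (.inr (.inl b))] at hq
  linarith

/-- Passing to non-neighbours for the vertices of degree 14 replaces sets of 12 points by sets of 6,
and turns the constants 8, 4 and 18 of the quadratic equation into 2. This makes the two halves
symmetric. -/
theorem isConfig : IsConfig H.coind (fun y z => H.ind (.inr (.inr y)) (.inr (.inr z)))
    (fun y z => H.ind (.inr (.inl y)) (.inr (.inl z)))
    (fun y x => H.ind (.inr (.inr y)) (.inl x)) (fun y x => 1 - H.ind (.inr (.inl y)) (.inl x)) := by
  have kself : ∀ x, H.coind x x = 0 := by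
    intro x; unfold SimpleGraph.coind; rw [H.ind_self]; simp
  have kcomm : ∀ x y, H.coind x y = H.coind y x := by
    intro x y; unfold SimpleGraph.coind; rw [H.ind_comm (.inl x)]; simp only [eq_comm]
  have pointb : ∀ x, ∑ b : Fin 9, (1 - H.ind (.inr (.inl b)) (.inl x)) = 3 := by
    intro x; rw [Finset.sum_sub_distrib, (h.sums_x x).2.1]; simp
  refine ⟨fun x y => ?_, kself, kcomm, fun x => (h.sums_x x).1,
    ⟨fun _ _ => H.ind_zero_or_one _ _, fun _ => H.ind_self _, fun _ _ => H.ind_comm _ _,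
      fun c => (h.sums_c c).2, fun _ _ => H.ind_zero_or_one _ _, fun x => (h.sums_x x).2.2,
      fun c => (h.sums_c c).1, fun y z => ?_, fun x c => h.wave_c x c⟩,
    ⟨fun _ _ => H.ind_zero_or_one _ _, fun _ => H.ind_self _, fun _ _ => H.ind_comm _ _,
      fun c => (h.sums_b c).2, fun y x => ?_, pointb,
      fun b => ?_, fun y z => ?_, fun x b => h.wave_b x b⟩, fun c b => ?_, fun x x' => ?_⟩
  · unfold SimpleGraph.coind
    by_cases hxy : x = y
    · subst hxy; rw [H.ind_self]; simp
    · rcases H.ind_zero_or_one (.inl x) (.inl y) with e | e <;> rw [e] <;> simp [hxy]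
  · have hq := h.quad (.inr (.inr y)) (.inr (.inr z))
    rw [sum_split] at hq
    simp only [Vertex.weight, h.no_edge, H.ind_comm (.inl _) (.inr (.inr _)), mul_zero,
      Finset.sum_const_zero, Sum.inr.injEq] at hq
    linarith
  · rcases H.ind_zero_or_one (.inr (.inl y)) (.inl x) with e | e <;> rw [e] <;> simp
  · rw [Finset.sum_sub_distrib, (h.sums_b b).1]; simp
  · have hq := h.quad (.inr (.inl y)) (.inr (.inl z))
    rw [sum_split] at hq
    simp only [Vertex.weight, h.no_edge, H.ind_comm (.inl _) (.inr (.inl _)), zero_mul,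
      Finset.sum_const_zero, Sum.inr.injEq, Sum.inl.injEq] at hq
    have e1 : ∑ x, (1 - H.ind (.inr (.inl y)) (.inl x)) * (1 - H.ind (.inr (.inl z)) (.inl x)) =
        18 - ∑ x, H.ind (.inr (.inl y)) (.inl x) - ∑ x, H.ind (.inr (.inl z)) (.inl x) +
        ∑ x, H.ind (.inr (.inl y)) (.inl x) * H.ind (.inr (.inl z)) (.inl x) := by
      have : (18 : ℤ) = ∑ _x : Fin 18, 1 := by simp
      rw [this, ← Finset.sum_sub_distrib, ← Finset.sum_sub_distrib, ← Finset.sum_add_distrib]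
      exact Finset.sum_congr rfl fun _ _ => by ring
    rw [e1, (h.sums_b y).1, (h.sums_b z).1]
    linarith
  · have hq := h.quad (.inr (.inr c)) (.inr (.inl b))
    rw [sum_split, if_neg (by simp)] at hq
    simp only [Vertex.weight, H.ind_comm (.inr (.inr _)) (.inr (.inl _)), h.no_edge, mul_zero,
      zero_mul, H.ind_comm (.inl _) (.inr (.inl _)), Finset.sum_const_zero] at hq
    simp only [mul_sub, mul_one]
    rw [Finset.sum_sub_distrib, (h.sums_c c).1]
    linarith
  · have hq := h.quad (.inl x) (.inl x')
    rw [sum_split] at hq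
    simp only [Vertex.weight, H.ind_comm (.inl x) (.inr _), Sum.inl.injEq,
      ] at hq
    have e1 : ∑ t, H.coind x t * H.coind t x' = ∑ t, H.coind x t - H.coind x x' -
        (∑ t, H.ind (.inl x') (.inl t) - H.ind (.inl x) (.inl x') -
          ∑ t, H.ind (.inl x) (.inl t) * H.ind (.inl t) (.inl x')) := by
      have : ∀ t, H.coind x t * H.coind t x' = H.coind x t - (if t = x' then H.coind x t else 0) -
        (H.ind (.inl x') (.inl t) - (if x = t then H.ind (.inl t) (.inl x') else 0) -
          H.ind (.inl x) (.inl t) * H.ind (.inl t) (.inl x')) := by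
        intro t
        rw [H.ind_comm (.inl x') (.inl t)]
        simp only [SimpleGraph.coind]
        split_ifs <;> ring
      rw [Finset.sum_congr rfl fun t _ => this t]
      simp only [Finset.sum_sub_distrib, Finset.sum_ite_eq, Finset.sum_ite_eq', Finset.mem_univ,
        if_true]
    have e2 : ∑ t, H.ind (.inl x') (.inl t) = 17 - ∑ t, H.coind x' t := by
      unfold SimpleGraph.coind
      rw [Finset.sum_sub_distrib, Finset.sum_sub_distrib]
      simp
    have e3 : ∑ z, (1 - H.ind (.inr (.inl z)) (.inl x)) * (1 - H.ind (.inr (.inl z)) (.inl x')) =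
        9 - ∑ z, H.ind (.inr (.inl z)) (.inl x) - ∑ z, H.ind (.inr (.inl z)) (.inl x') +
        ∑ z, H.ind (.inr (.inl z)) (.inl x) * H.ind (.inr (.inl z)) (.inl x') := by
      have : (9 : ℤ) = ∑ _x : Fin 9, 1 := by simp
      rw [this, ← Finset.sum_sub_distrib, ← Finset.sum_sub_distrib, ← Finset.sum_add_distrib]
      exact Finset.sum_congr rfl fun _ _ => by ring
    rw [e1, e2, e3, (h.sums_x x).1, (h.sums_x x').1, (h.sums_x x).2.1, (h.sums_x x').2.1]
    linarith

end SimpleGraph.IsQuadratic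

/-! ### Cycles in 2-regular graphs -/

theorem exists_pair_of_sum_eq_two {α : Type*} [Fintype α] [DecidableEq α] {f : α → ℤ}
    (h01 : ∀ x, f x = 0 ∨ f x = 1) (hs : ∑ x, f x = 2) :
    ∃ y z, y ≠ z ∧ ∀ w, f w = 1 ↔ w = y ∨ w = z := by
  have h1 : ∑ x, f x = ((Finset.univ.filter fun x => f x = 1).card : ℤ) := by
    rw [Finset.card_filter]
    push_cast
    refine Finset.sum_congr rfl fun x _ => ?_
    rcases h01 x with e | e <;> rw [e] <;> simp
  have h2 : (Finset.univ.filter fun x => f x = 1).card = 2 := by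
    rw [hs] at h1; exact_mod_cast h1.symm
  obtain ⟨y, z, hyz, h3⟩ := Finset.card_eq_two.1 h2
  refine ⟨y, z, hyz, fun w => ?_⟩
  have : w ∈ Finset.univ.filter (fun x => f x = 1) ↔ w ∈ ({y, z} : Finset α) := by rw [h3]
  simpa using this

theorem sum_mul_of_pair {α : Type*} [Fintype α] [DecidableEq α] {f : α → ℤ}
    (h01 : ∀ x, f x = 0 ∨ f x = 1) {y z : α} (hyz : y ≠ z) (hf : ∀ w, f w = 1 ↔ w = y ∨ w = z)
    (g : α → ℤ) : ∑ x, f x * g x = g y + g z := by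
  have h1 : ∀ x, f x * g x = (if x = y then g x else 0) + (if x = z then g x else 0) := by
    intro x
    by_cases hy : x = y
    · subst hy
      rw [(hf x).2 (Or.inl rfl)]; simp [hyz]
    by_cases hz : x = z
    · subst hz
      rw [(hf x).2 (Or.inr rfl)]; simp [hy]
    · rw [(h01 x).resolve_right fun h => ((hf x).1 h).elim hy hz]; simp [hy, hz]
  rw [Finset.sum_congr rfl fun x _ => h1 x, Finset.sum_add_distrib]
  simp

/-- `R` is the adjacency relation of a `2`-regular graph. -/
structure IsTwoRegular {α : Type*} (R : α → α → Prop) : Prop where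
  symm : ∀ {x y}, R x y → R y x
  irrefl : ∀ x, ¬ R x x
  exists_pair : ∀ x, ∃ y z, y ≠ z ∧ ∀ w, R x w ↔ w = y ∨ w = z

/-- `p` walks through a `2`-regular graph without turning back. -/
def IsWalkSeq {α : Type*} (R : α → α → Prop) (p : ℕ → α) : Prop :=
  ∀ n, p n ≠ p (n + 2) ∧ ∀ w, R (p (n + 1)) w ↔ w = p n ∨ w = p (n + 2)

namespace IsTwoRegular

variable {α : Type*} {R : α → α → Prop} (hR : IsTwoRegular R)

include hR

theorem exists_other {x y : α} (h : R x y) : ∃ z, x ≠ z ∧ ∀ w, R y w ↔ w = x ∨ w = z := by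
  obtain ⟨a, b, hab, hw⟩ := hR.exists_pair y
  rcases (hw x).1 (hR.symm h) with e | e
  · exact ⟨b, e ▸ hab, fun w => by rw [hw, e]⟩
  · exact ⟨a, e ▸ hab.symm, fun w => by rw [hw, e]; tauto⟩

theorem exists_walk {x y : α} (h : R x y) : ∃ p : ℕ → α, p 0 = x ∧ p 1 = y ∧ IsWalkSeq R p := by
  have hstep : ∀ s : {s : α × α // R s.1 s.2}, ∃ s' : {s : α × α // R s.1 s.2},
      s'.1.1 = s.1.2 ∧ s.1.1 ≠ s'.1.2 ∧ ∀ w, R s.1.2 w ↔ w = s.1.1 ∨ w = s'.1.2 := by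
    rintro ⟨⟨a, b⟩, hab⟩
    obtain ⟨c, hc, hw⟩ := hR.exists_other hab
    exact ⟨⟨(b, c), (hw c).2 (Or.inr rfl)⟩, rfl, hc, hw⟩
  choose F hF using hstep
  let s : ℕ → {s : α × α // R s.1 s.2} := fun n => F^[n] ⟨(x, y), h⟩
  have hs : ∀ n, s (n + 1) = F (s n) := fun n => Function.iterate_succ_apply' F n _
  have hsnd : ∀ n, (s n).1.2 = (s (n + 1)).1.1 := fun n => by rw [hs, (hF _).1]
  refine ⟨fun n => (s n).1.1, rfl, (hsnd 0).symm, fun n => ?_⟩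
  have h1 := (hF (s n)).2
  rw [← hs, hsnd n, hsnd (n + 1)] at h1
  exact h1

omit hR in
theorem adj_walk {p : ℕ → α} (hp : IsWalkSeq R p) (n : ℕ) : R (p (n + 1)) (p n) :=
  ((hp n).2 _).2 (Or.inl rfl)

/-- At the first repetition p j = p n the index j is 0: otherwise p (n - 1), being a neighbour of p
j, would equal p (j - 1) or p (j + 1), which is an earlier repetition. -/
theorem exists_cycle [Finite α] {p : ℕ → α} (hp : IsWalkSeq R p) :
    ∃ n, 3 ≤ n ∧ (∀ i j, i < n → j < n → p i = p j → i = j) ∧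
      ∀ i, i < n → ∀ w, R (p i) w ↔ w = p ((i + 1) % n) ∨ w = p ((i + (n - 1)) % n) := by
  classical
  have hne1 : ∀ n, p n ≠ p (n + 1) := fun n h => hR.irrefl (p (n + 1)) (by
    have := adj_walk hp n; rwa [h] at this)
  have hex : ∃ n, ∃ j, j < n ∧ p j = p n := by
    obtain ⟨a, b, hab, h⟩ := Finite.exists_ne_map_eq_of_infinite p
    rcases lt_or_gt_of_ne hab with hlt | hlt
    · exact ⟨b, a, hlt, h⟩
    · exact ⟨a, b, hlt, h.symm⟩
  obtain ⟨j, hj, hjn⟩ := Nat.find_spec hex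
  set n := Nat.find hex with hn
  have hmin : ∀ i k, i < k → k < n → p i ≠ p k := fun i k hik hk h =>
    Nat.find_min hex hk ⟨i, hik, h⟩
  have hinj : ∀ i j, i < n → j < n → p i = p j → i = j := by
    intro i k hi hk h
    rcases lt_trichotomy i k with hlt | heq | hlt
    · exact absurd h (hmin i k hlt hk)
    · exact heq
    · exact absurd h.symm (hmin k i hlt hi)
  -- There are no loops and the walk does not turn back, so a return takes at least three steps.
  have hn1 : n ≠ j + 1 := fun h => hne1 j (by rw [← h]; exact hjn)
  have hn2 : n ≠ j + 2 := fun h => (hp j).1 (by rw [← h]; exact hjn)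
  have hadj : R (p n) (p (n - 1)) := by
    have := adj_walk hp (n - 1)
    rwa [Nat.sub_add_cancel (by omega)] at this
  have hj0 : j = 0 := by
    by_contra hj0
    rw [← hjn] at hadj
    obtain ⟨i, rfl⟩ := Nat.exists_eq_succ_of_ne_zero hj0
    rcases ((hp i).2 _).1 hadj with e | e
    · have := hinj _ _ (by omega) (by omega) e; omega
    · have := hinj _ _ (by omega) (by omega) e; omega
  subst hj0
  refine ⟨n, by omega, hinj, fun i hi w => ?_⟩
  rcases Nat.eq_zero_or_pos i with rfl | hpos
  · rw [zero_add, zero_add, Nat.mod_eq_of_lt (show 1 < n by omega),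
      Nat.mod_eq_of_lt (show n - 1 < n by omega)]
    obtain ⟨z, hz, hw⟩ := hR.exists_other (adj_walk hp 0)
    have h1 : R (p 0) (p (n - 1)) := by rw [hjn]; exact hadj
    rcases (hw _).1 h1 with e | e
    · have := hinj _ _ (by omega) (by omega) e; omega
    · rw [hw, e]
  · obtain ⟨k, rfl⟩ := Nat.exists_eq_succ_of_ne_zero hpos.ne'
    have h1 : p ((k + 1 + (n - 1)) % n) = p k := by
      have : k + 1 + (n - 1) = k + n := by omega
      rw [this, Nat.add_mod_right, Nat.mod_eq_of_lt (by omega)]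
    have h2 : p ((k + 1 + 1) % n) = p (k + 2) := by
      rcases Nat.lt_or_ge (k + 2) n with hlt | hge
      · rw [Nat.mod_eq_of_lt hlt]
      · have : n = k + 2 := by omega
        rw [← this, Nat.mod_self, hjn]
    simp only [Nat.succ_eq_add_one]
    rw [h1, h2, (hp k).2 w]
    tauto

omit hR in
theorem walk_mem {p : ℕ → α} (hp : IsWalkSeq R p) (hsymm : ∀ {x y}, R x y → R y x) {Q : α → Prop}
    (hQ : ∀ x y, Q x → R x y → Q y) (h0 : Q (p 0)) (n : ℕ) : Q (p n) := by
  induction n with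
  | zero => exact h0
  | succ n ih => exact hQ _ _ ih (hsymm (adj_walk hp n))

end IsTwoRegular

/-! ### The possible cycle types of the block graph -/

/-- The successor of `i` in the union of cycles on `{0, …, 8}` of lengths `3 + 3 + 3`, `6 + 3` or `9`,
according as `t` is `0`, `1` or larger. -/
def nextIdx (t i : ℕ) : ℕ :=
  match t with
  | 0 => 3 * (i / 3) + (i + 1) % 3
  | 1 => if i < 6 then (i + 1) % 6 else 6 + (i + 1) % 3
  | _ => (i + 1) % 9

/-- The predecessor of `i`, see `nextIdx`. -/
def prevIdx (t i : ℕ) : ℕ :=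
  match t with
  | 0 => 3 * (i / 3) + (i + 2) % 3
  | 1 => if i < 6 then (i + 5) % 6 else 6 + (i + 2) % 3
  | _ => (i + 8) % 9

/-- `q` labels the vertices of `D` so that `D` becomes a standard union of cycles. -/
structure IsLabelling (t : ℕ) (D : Fin 9 → Fin 9 → ℤ) (q : ℕ → Fin 9) : Prop where
  inj : ∀ i j, i < 9 → j < 9 → q i = q j → i = j
  adj : ∀ i, i < 9 → ∀ w, D (q i) w = 1 ↔ w = q (nextIdx t i) ∨ w = q (prevIdx t i)

namespace IsHalf

variable {κ : Fin 18 → Fin 18 → ℤ} {D : Fin 9 → Fin 9 → ℤ} {I : Fin 9 → Fin 18 → ℤ}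
  (h : IsHalf κ D I)

include h

theorem isTwoRegular : IsTwoRegular fun y z => D y z = 1 where
  symm := fun {x y} hxy => by rw [h.graph_comm]; exact hxy
  irrefl x := by simp [h.graph_self]
  exists_pair x := exists_pair_of_sum_eq_two (h.graph_zero_or_one x) (h.graph_regular x)

/-- A union of components of `D` meets every point in a third of its blocks. -/
theorem three_mul_sum_closed {P : Finset (Fin 9)} (hP : ∀ y z, y ∈ P → D y z = 1 → z ∈ P)
    (x : Fin 18) : 3 * ∑ y ∈ P, I y x = P.card := by
  have hsum : ∀ y ∈ P, ∑ z ∈ P, D y z = 2 := by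
    intro y hy
    rw [← h.graph_regular y]
    refine Finset.sum_subset (Finset.subset_univ _) fun z _ hz => ?_
    exact (h.graph_zero_or_one y z).resolve_right fun e => hz (hP y z hy e)
  have hrow : ∀ y ∈ P, ∑ z ∈ P, ∑ x, I y x * I z x = 2 * P.card := by
    intro y hy
    have h1 : ∀ z, ∑ x, I y x * I z x =
        (if y = z then 6 else 0) + 2 - D y z - ∑ t, D y t * D t z := fun z => by
      rw [← h.inter y z]; ring
    rw [Finset.sum_congr rfl fun z _ => h1 z, Finset.sum_sub_distrib, Finset.sum_sub_distrib,
      Finset.sum_add_distrib, hsum y hy, Finset.sum_comm (s := P)]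
    have h2 : ∀ t, ∑ z ∈ P, D y t * D t z = D y t * 2 := by
      intro t
      rw [← Finset.mul_sum]
      rcases h.graph_zero_or_one y t with e | e
      · rw [e]; simp
      · rw [hsum t (hP y t hy e)]
    rw [Finset.sum_congr rfl fun t _ => h2 t, ← Finset.sum_mul, h.graph_regular,
      Finset.sum_ite_eq, if_pos hy]
    simp; ring
  have hs1 : ∑ x, ∑ y ∈ P, I y x = 6 * P.card := by
    rw [Finset.sum_comm, Finset.sum_congr rfl fun y _ => h.block_size y]
    simp; ring
  have hs2 : ∑ x, (∑ y ∈ P, I y x) * (∑ y ∈ P, I y x) = 2 * (P.card * P.card) := by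
    simp only [Finset.sum_mul_sum]
    rw [Finset.sum_comm, Finset.sum_congr rfl fun y hy => by
      rw [Finset.sum_comm, hrow y hy]]
    simp; ring
  -- With n the size of P, the first two moments of the number of blocks of P on a point give 9 ·
  -- 2n² - 6n · 6n + 18n² = 0.
  have hvar : ∑ x, (3 * ∑ y ∈ P, I y x - P.card) ^ 2 = 0 := by
    have : ∀ x, (3 * ∑ y ∈ P, I y x - (P.card : ℤ)) ^ 2 =
        9 * ((∑ y ∈ P, I y x) * (∑ y ∈ P, I y x)) - 6 * P.card * (∑ y ∈ P, I y x) +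
        P.card * P.card := fun x => by ring
    rw [Finset.sum_congr rfl fun x _ => this x, Finset.sum_add_distrib, Finset.sum_sub_distrib,
      ← Finset.mul_sum, ← Finset.mul_sum, hs1, hs2]
    simp; ring
  have h0 := (Finset.sum_eq_zero_iff_of_nonneg fun x _ => sq_nonneg _).1 hvar x (Finset.mem_univ _)
  have := pow_eq_zero_iff (two_ne_zero) |>.1 h0
  linarith

/-- A cycle is a union of components, so `three_mul_sum_closed` makes its length divisible by 3. The
predicate `Q` keeps the cycle off the blocks already used. -/
theorem exists_cycle_in (Q : Fin 9 → Prop) (hQ : ∀ x y, Q x → D x y = 1 → Q y) (y : Fin 9)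
    (hy : Q y) : ∃ (n : ℕ) (p : ℕ → Fin 9), (n = 3 ∨ n = 6 ∨ n = 9) ∧ p 0 = y ∧ (∀ i, Q (p i)) ∧
      (∀ i j, i < n → j < n → p i = p j → i = j) ∧
      ∀ i, i < n → ∀ w, D (p i) w = 1 ↔ w = p ((i + 1) % n) ∨ w = p ((i + (n - 1)) % n) := by
  obtain ⟨z, z', -, hz⟩ := h.isTwoRegular.exists_pair y
  obtain ⟨p, hp0, -, hp⟩ := h.isTwoRegular.exists_walk ((hz z).2 (Or.inl rfl))
  obtain ⟨n, hn, hinj, hadj⟩ := h.isTwoRegular.exists_cycle hp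
  refine ⟨n, p, ?_, hp0, fun i => ?_, hinj, hadj⟩
  · have hcard : ((Finset.range n).image p).card = n := by
      rw [Finset.card_image_of_injOn, Finset.card_range]
      intro i hi j hj hij
      exact hinj i j (by simpa using hi) (by simpa using hj) hij
    have h9 : n ≤ 9 := by
      rw [← hcard]; simpa using Finset.card_le_univ ((Finset.range n).image p)
    -- Any point serves here; only divisibility of the cardinality is needed.
    have h3 := h.three_mul_sum_closed (P := (Finset.range n).image p) (fun a b ha hab => by
      obtain ⟨i, hi, rfl⟩ := Finset.mem_image.1 ha
      rcases (hadj i (Finset.mem_range.1 hi) b).1 hab with e | e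
      · rw [e]; exact Finset.mem_image_of_mem _ (Finset.mem_range.2 (Nat.mod_lt _ (by omega)))
      · rw [e]; exact Finset.mem_image_of_mem _ (Finset.mem_range.2 (Nat.mod_lt _ (by omega)))) 0
    rw [hcard] at h3
    omega
  · refine IsTwoRegular.walk_mem (Q := Q) hp h.isTwoRegular.symm hQ ?_ i
    rw [hp0]; exact hy

omit h in
theorem compl_closed (hcomm : ∀ y z, D y z = D z y) {n : ℕ} (hn : 0 < n) {p : ℕ → Fin 9}
    (hadj : ∀ i, i < n → ∀ w, D (p i) w = 1 ↔ w = p ((i + 1) % n) ∨ w = p ((i + (n - 1)) % n))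
    (x y : Fin 9) (hx : ∀ i, i < n → p i ≠ x) (hxy : D x y = 1) : ∀ i, i < n → p i ≠ y := by
  rintro i hi rfl
  rw [hcomm] at hxy
  rcases (hadj i hi x).1 hxy with e | e
  · exact hx _ (Nat.mod_lt _ hn) e.symm
  · exact hx _ (Nat.mod_lt _ hn) e.symm

omit h in
theorem exists_not_mem (n : ℕ) (hn : n < 9) (p : ℕ → Fin 9) : ∃ y, ∀ i, i < n → p i ≠ y := by
  have : ((Finset.range n).image p).card < Fintype.card (Fin 9) :=
    lt_of_le_of_lt Finset.card_image_le (by simpa using hn)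
  obtain ⟨y, hy⟩ : ∃ y, y ∉ (Finset.range n).image p := by
    by_contra hcon
    exact (Finset.card_lt_iff_ne_univ _).1 this
      (Finset.eq_univ_iff_forall.2 fun y => not_not.1 fun hy => hcon ⟨y, hy⟩)
  exact ⟨y, fun i hi e => hy (Finset.mem_image.2 ⟨i, Finset.mem_range.2 hi, e⟩)⟩

/-- The cases are those of a longest cycle of length 9, 6 or 3. The complement of a cycle is closed
under adjacency, so further cycles are found inside it. -/
theorem exists_labelling : ∃ t, t < 3 ∧ ∃ q, IsLabelling t D q := by
  have hc := h.graph_comm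
  by_cases h9 : ∃ p : ℕ → Fin 9, (∀ i j, i < 9 → j < 9 → p i = p j → i = j) ∧
      ∀ i, i < 9 → ∀ w, D (p i) w = 1 ↔ w = p ((i + 1) % 9) ∨ w = p ((i + (9 - 1)) % 9)
  · obtain ⟨p, hinj, hadj⟩ := h9
    exact ⟨2, by norm_num, p, hinj, hadj⟩
  by_cases h6 : ∃ p : ℕ → Fin 9, (∀ i j, i < 6 → j < 6 → p i = p j → i = j) ∧
      ∀ i, i < 6 → ∀ w, D (p i) w = 1 ↔ w = p ((i + 1) % 6) ∨ w = p ((i + (6 - 1)) % 6)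
  · obtain ⟨p, hinj, hadj⟩ := h6
    obtain ⟨y, hy⟩ := exists_not_mem 6 (by norm_num) p
    obtain ⟨n, r, hn, -, hr, hrinj, hradj⟩ := h.exists_cycle_in (fun z => ∀ i, i < 6 → p i ≠ z)
      (fun a b ha hab => compl_closed hc (by norm_num) hadj a b ha hab) y hy
    have hn3 : n = 3 := by
      by_contra hn3
      -- Two disjoint cycles of at least six blocks each do not fit into nine blocks.
      have hn6 : 6 ≤ n := by omega
      have hc1 : ((Finset.range 6).image p).card = 6 := by
        rw [Finset.card_image_of_injOn, Finset.card_range]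
        intro i hi j hj hij
        exact hinj i j (by simpa using hi) (by simpa using hj) hij
      have hc2 : ((Finset.range 6).image r).card = 6 := by
        rw [Finset.card_image_of_injOn, Finset.card_range]
        intro i hi j hj hij
        have hi' : i < 6 := by simpa using hi
        have hj' : j < 6 := by simpa using hj
        exact hrinj i j (by omega) (by omega) hij
      have hdis : Disjoint ((Finset.range 6).image p) ((Finset.range 6).image r) := by
        rw [Finset.disjoint_left]
        rintro a ha hb
        obtain ⟨i, hi, rfl⟩ := Finset.mem_image.1 ha
        obtain ⟨j, hj, hij⟩ := Finset.mem_image.1 hb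
        exact hr j i (Finset.mem_range.1 hi) hij.symm
      have := Finset.card_le_univ ((Finset.range 6).image p ∪ (Finset.range 6).image r)
      rw [Finset.card_union_of_disjoint hdis, hc1, hc2] at this
      simp at this
    subst hn3
    refine ⟨1, by norm_num, fun i => if i < 6 then p i else r (i - 6), ⟨fun i j hi hj hij => ?_,
      fun i hi w => ?_⟩⟩
    · split_ifs at hij with h1 h2 h2
      · exact hinj i j h1 h2 hij
      · exact absurd hij (hr _ i h1)
      · exact absurd hij.symm (hr _ j h2)
      · have := hrinj _ _ (by omega) (by omega) hij; omega
    · simp only [nextIdx, prevIdx]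
      by_cases h1 : i < 6
      · rw [if_pos h1, if_pos h1, if_pos h1, if_pos (Nat.mod_lt _ (by norm_num)),
          if_pos (Nat.mod_lt _ (by norm_num)), hadj i h1 w]
      · rw [if_neg h1, if_neg h1, if_neg h1, if_neg (by omega), if_neg (by omega),
          hradj (i - 6) (by omega) w, Nat.add_sub_cancel_left, Nat.add_sub_cancel_left]
        have e1 : (i - 6 + 1) % 3 = (i + 1) % 3 := by omega
        have e2 : (i - 6 + (3 - 1)) % 3 = (i + 2) % 3 := by omega
        rw [e1, e2]
  · have h3 : ∀ (Q : Fin 9 → Prop) (_ : ∀ x y, Q x → D x y = 1 → Q y) (y : Fin 9) (_ : Q y),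
        ∃ p : ℕ → Fin 9, (∀ i, Q (p i)) ∧ (∀ i j, i < 3 → j < 3 → p i = p j → i = j) ∧
        ∀ i, i < 3 → ∀ w, D (p i) w = 1 ↔ w = p ((i + 1) % 3) ∨ w = p ((i + (3 - 1)) % 3) := by
      intro Q hQ y hy
      obtain ⟨n, p, hn, -, hp, hinj, hadj⟩ := h.exists_cycle_in Q hQ y hy
      rcases hn with rfl | rfl | rfl
      · exact ⟨p, hp, hinj, hadj⟩
      · exact absurd ⟨p, hinj, hadj⟩ h6
      · exact absurd ⟨p, hinj, hadj⟩ h9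
    obtain ⟨p, -, pinj, padj⟩ := h3 (fun _ => True) (fun _ _ _ _ => trivial) 0 trivial
    obtain ⟨y, hy⟩ := exists_not_mem 3 (by norm_num) p
    obtain ⟨r, hr, rinj, radj⟩ := h3 (fun z => ∀ i, i < 3 → p i ≠ z)
      (fun a b ha hab => compl_closed hc (by norm_num) padj a b ha hab) y hy
    obtain ⟨z, hz⟩ := exists_not_mem 6 (by norm_num) fun i => if i < 3 then p i else r (i - 3)
    obtain ⟨s, hs, sinj, sadj⟩ := h3
      (fun z => (∀ i, i < 3 → p i ≠ z) ∧ (∀ i, i < 3 → r i ≠ z))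
      (fun a b ha hab => ⟨compl_closed hc (by norm_num) padj a b ha.1 hab,
        compl_closed hc (by norm_num) radj a b ha.2 hab⟩) z
      ⟨fun i hi => by have := hz i (by omega); rwa [if_pos hi] at this,
        fun i hi => by
          have := hz (i + 3) (by omega)
          rwa [if_neg (by omega), Nat.add_sub_cancel] at this⟩
    refine ⟨0, by norm_num, fun i => if i < 3 then p i else if i < 6 then r (i - 3) else s (i - 6),
      ⟨fun i j hi hj hij => ?_, fun i hi w => ?_⟩⟩
    · split_ifs at hij with h1 h2 h3 h2 h3 h4 h5 h6
      · exact pinj i j h1 h2 hij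
      · exact absurd hij (hr _ i h1)
      · exact absurd hij ((hs _).1 i h1)
      · exact absurd hij.symm (hr _ j h3)
      · have := rinj _ _ (by omega) (by omega) hij; omega
      · exact absurd hij ((hs _).2 _ (by omega))
      · exact absurd hij.symm ((hs _).1 j h5)
      · exact absurd hij.symm ((hs _).2 _ (by omega))
      · have := sinj _ _ (by omega) (by omega) hij; omega
    · simp only [nextIdx, prevIdx]
      by_cases h1 : i < 3
      · rw [if_pos h1, if_pos (by omega), if_pos (by omega), padj i h1 w]
        have e1 : 3 * (i / 3) + (i + 1) % 3 = (i + 1) % 3 := by omega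
        have e2 : 3 * (i / 3) + (i + 2) % 3 = (i + (3 - 1)) % 3 := by omega
        rw [e1, e2]
      by_cases h2 : i < 6
      · rw [if_neg h1, if_pos h2, if_neg (by omega), if_pos (by omega), if_neg (by omega),
          if_pos (by omega), radj (i - 3) (by omega) w]
        have e1 : 3 * (i / 3) + (i + 1) % 3 - 3 = (i - 3 + 1) % 3 := by omega
        have e2 : 3 * (i / 3) + (i + 2) % 3 - 3 = (i - 3 + (3 - 1)) % 3 := by omega
        rw [e1, e2]
      · rw [if_neg h1, if_neg h2, if_neg (by omega), if_neg (by omega), if_neg (by omega),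
          if_neg (by omega), sadj (i - 6) (by omega) w]
        have e1 : 3 * (i / 3) + (i + 1) % 3 - 6 = (i - 6 + 1) % 3 := by omega
        have e2 : 3 * (i / 3) + (i + 2) % 3 - 6 = (i - 6 + (3 - 1)) % 3 := by omega
        rw [e1, e2]

end IsHalf

/-! ### Points as binary masks -/

/-- The number whose binary digits below `2 ^ n` are given by `f`. -/
def ofDigits : ℕ → (ℕ → Bool) → ℕ
  | 0, _ => 0
  | n + 1, f => 2 ^ n * (f n).toNat + ofDigits n f

theorem ofDigits_lt (n : ℕ) (f : ℕ → Bool) : ofDigits n f < 2 ^ n := by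
  induction n with
  | zero => simp [ofDigits]
  | succ n ih =>
    rw [ofDigits, pow_succ]
    have : (f n).toNat ≤ 1 := Bool.toNat_le _
    nlinarith [Nat.pos_of_ne_zero (pow_ne_zero n (two_ne_zero (α := ℕ)))]

theorem testBit_ofDigits (n : ℕ) (f : ℕ → Bool) (i : ℕ) :
    (ofDigits n f).testBit i = (decide (i < n) && f i) := by
  induction n with
  | zero => simp [ofDigits]
  | succ n ih =>
    rw [ofDigits, Nat.testBit_two_pow_mul_add _ (ofDigits_lt n f)]
    by_cases h : i < n
    · rw [if_pos h, ih]; simp [h, Nat.lt_succ_of_lt h]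
    · rw [if_neg h]
      by_cases h' : i = n
      · subst h'; cases f i <;> simp
      · have h1 : ¬ i < n + 1 := by omega
        have h2 : (f n).toNat < 2 ^ (i - n) := by
          have h3 : (f n).toNat ≤ 1 := Bool.toNat_le _
          have h4 : 1 < 2 ^ (i - n) := Nat.one_lt_two_pow (by omega)
          omega
        rw [Nat.testBit_lt_two_pow h2]; simp [h1]

/-- The number of ones among the last `n` binary digits. -/
def digitSum : ℕ → ℕ → ℕ
  | 0, _ => 0
  | n + 1, s => (s.testBit n).toNat + digitSum n s

theorem digitSum_eq_sum (n s : ℕ) : digitSum n s = ∑ i ∈ Finset.range n, (s.testBit i).toNat := by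
  induction n with
  | zero => rfl
  | succ n ih => rw [digitSum, ih, Finset.sum_range_succ, add_comm]

/-- Substitution `p` of digit positions in a nine-digit mask. -/
def permMask (p : ℕ → ℕ) (s : ℕ) : ℕ := ofDigits 9 fun i => s.testBit (p i)

theorem testBit_permMask (p : ℕ → ℕ) (s i : ℕ) :
    (permMask p s).testBit i = (decide (i < 9) && s.testBit (p i)) := testBit_ofDigits _ _ _

/-- The mask with digits `s (nextIdx t i)`, computed by shifts. -/
def nextMask (t s : ℕ) : ℕ :=
  match t with
  | 0 => (s >>> 1 &&& 219) ||| (s &&& 73) <<< 2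
  | 1 => (s >>> 1 &&& 223) ||| (s &&& 1) <<< 5 ||| (s &&& 64) <<< 2
  | _ => s >>> 1 ||| (s &&& 1) <<< 8

/-- The mask with digits `s (prevIdx t i)`, computed by shifts. -/
def prevMask (t s : ℕ) : ℕ :=
  match t with
  | 0 => (s <<< 1 &&& 438) ||| (s >>> 2 &&& 73)
  | 1 => (s <<< 1 &&& 446) ||| (s >>> 5 &&& 1) ||| (s >>> 2 &&& 64)
  | _ => (s <<< 1 &&& 510) ||| s >>> 8

theorem nextMask_prevMask {t s : ℕ} (ht : t < 3) (hs : s < 512) :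
    nextMask t s = permMask (nextIdx t) s ∧ prevMask t s = permMask (prevIdx t) s := by
  have h : (List.range 3).all (fun t => (List.range 512).all fun s =>
      nextMask t s == permMask (nextIdx t) s && prevMask t s == permMask (prevIdx t) s) = true := by
    decide +kernel
  simp only [List.all_eq_true, List.mem_range, Bool.and_eq_true, beq_iff_eq] at h
  exact h t ht s hs

/-- The mask `s''` for which `s' + s''` is, digit by digit, the sum of the two shifts of `s`. -/
def thirdMask (t s s' : ℕ) : ℕ := s' ^^^ (nextMask t s ^^^ prevMask t s)

/-- Whether `s'` and `thirdMask t s s'` do add up to the two shifts of `s`. -/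
def isStep (t s s' : ℕ) : Bool :=
  Nat.beq (s' &&& thirdMask t s s') (nextMask t s &&& prevMask t s)

/-- The components of the standard union of cycles. -/
def components : ℕ → List (List ℕ)
  | 0 => [[0, 1, 2], [3, 4, 5], [6, 7, 8]]
  | 1 => [[0, 1, 2, 3, 4, 5], [6, 7, 8]]
  | _ => [[0, 1, 2, 3, 4, 5, 6, 7, 8]]

/-- The masks that meet every component in a third of its elements. -/
def masks : ℕ → List ℕ
  | 0 => [1, 2, 4].flatMap fun a => [8, 16, 32].flatMap fun b => [64, 128, 256].map fun c => a + b + c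
  | 1 => (List.range 6).flatMap fun i => (List.range i).flatMap fun j =>
      [64, 128, 256].map fun c => 2 ^ i + 2 ^ j + c
  | _ => (List.range 9).flatMap fun i => (List.range i).flatMap fun j => (List.range j).map fun k =>
      2 ^ i + 2 ^ j + 2 ^ k

theorem mem_masks {t s : ℕ} (ht : t < 3) (hs : s < 512)
    (h : ∀ c ∈ components t, 3 * c.countP s.testBit = c.length) : s ∈ masks t := by
  have key : (List.range 3).all (fun t => (List.range 512).all fun s =>
      !((components t).all fun c => 3 * c.countP s.testBit == c.length) ||
        (masks t).contains s) = true := by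
    decide +kernel
  simp only [List.all_eq_true, List.mem_range, Bool.or_eq_true, Bool.not_eq_true',
    List.contains_iff_mem] at key
  refine (key t ht s hs).resolve_left ?_
  rw [Bool.not_eq_false, List.all_eq_true]
  intro c hc
  rw [beq_iff_eq]
  exact h c hc

theorem lt_of_mem_masks {t s : ℕ} (ht : t < 3) (hs : s ∈ masks t) : s < 512 := by
  have key : (List.range 3).all (fun t => (masks t).all fun s => Nat.blt s 512) = true := by
    decide +kernel
  simp only [List.all_eq_true, List.mem_range, Nat.blt_eq] at key
  exact key t ht s hs

/-- Adjacency in the standard union of cycles. -/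
def cycleAdj (t i j : ℕ) : ℕ := if j = nextIdx t i ∨ j = prevIdx t i then 1 else 0

/-- The number of points common to two blocks. -/
def interSize (t i j : ℕ) : ℕ :=
  -- Off the diagonal IIᵀ + D + D² = 2, and the bracket is the entry of D². So the subtraction is
  -- not truncated for two different blocks of a half.
  2 - cycleAdj t i j - (cycleAdj t (nextIdx t i) j + cycleAdj t (prevIdx t i) j)

theorem nextIdx_prevIdx {t i : ℕ} (ht : t < 3) (hi : i < 9) :
    nextIdx t i < 9 ∧ prevIdx t i < 9 ∧ nextIdx t i ≠ prevIdx t i := by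
  interval_cases t <;> simp only [nextIdx, prevIdx] <;> (try split_ifs) <;> omega

/-- The mask of the set of blocks through the point `x`. -/
noncomputable def pointMask (q : ℕ → Fin 9) (I : Fin 9 → Fin 18 → ℤ) (x : Fin 18) : ℕ :=
  ofDigits 9 fun i => decide (I (q i) x = 1)

theorem testBit_pointMask (q : ℕ → Fin 9) (I : Fin 9 → Fin 18 → ℤ) (x : Fin 18) (i : ℕ) :
    (pointMask q I x).testBit i = (decide (i < 9) && decide (I (q i) x = 1)) :=
  testBit_ofDigits _ _ _

theorem IsLabelling.sum_eq {t : ℕ} {D : Fin 9 → Fin 9 → ℤ} {q : ℕ → Fin 9} (hq : IsLabelling t D q)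
    {M : Type*} [AddCommMonoid M] (g : Fin 9 → M) : ∑ y, g y = ∑ i ∈ Finset.range 9, g (q i) := by
  have hinj : Set.InjOn q (Finset.range 9 : Finset ℕ) := fun i hi j hj hij =>
    hq.inj i j (by simpa using hi) (by simpa using hj) hij
  have huniv : (Finset.range 9).image q = Finset.univ := by
    apply Finset.eq_univ_of_card
    rw [Finset.card_image_of_injOn hinj]; simp
  rw [← huniv, Finset.sum_image hinj]

namespace IsHalf

variable {κ : Fin 18 → Fin 18 → ℤ} {D : Fin 9 → Fin 9 → ℤ} {I : Fin 9 → Fin 18 → ℤ}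
  (h : IsHalf κ D I) {t : ℕ} {q : ℕ → Fin 9} (hq : IsLabelling t D q)

include h

theorem inc_eq (x : Fin 18) {i : ℕ} (hi : i < 9) :
    I (q i) x = ((pointMask q I x).testBit i).toNat := by
  rw [testBit_pointMask]
  rcases h.inc_zero_or_one (q i) x with e | e <;> simp [hi, e]

include hq

omit h in
theorem graph_eq (h01 : ∀ y z, D y z = 0 ∨ D y z = 1) (ht : t < 3) {i j : ℕ} (hi : i < 9)
    (hj : j < 9) : D (q i) (q j) = cycleAdj t i j := by
  obtain ⟨h1, h2, -⟩ := nextIdx_prevIdx ht hi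
  unfold cycleAdj
  split_ifs with hc
  · rw [Nat.cast_one, hq.adj i hi]
    rcases hc with rfl | rfl
    · left; rfl
    · right; rfl
  · rw [Nat.cast_zero]
    refine (h01 _ _).resolve_right fun e => hc ?_
    rcases (hq.adj i hi _).1 e with e | e
    · left; exact hq.inj _ _ hj h1 e
    · right; exact hq.inj _ _ hj h2 e

/-- This is `three_mul_sum_closed` for each component of the block graph. -/
theorem pointMask_mem (ht : t < 3) (x : Fin 18) : pointMask q I x ∈ masks t := by
  refine mem_masks ht (ofDigits_lt 9 _) fun c hc => ?_
  have hc' : c.Nodup ∧ ∀ i ∈ c, i < 9 ∧ nextIdx t i ∈ c ∧ prevIdx t i ∈ c := by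
    clear hq
    interval_cases t <;> revert c <;> decide
  obtain ⟨hnd, hcl⟩ := hc'
  have hinj : Set.InjOn q (c.toFinset : Finset ℕ) := fun i hi j hj hij =>
    hq.inj i j (hcl i (by simpa using hi)).1 (hcl j (by simpa using hj)).1 hij
  have h1 := h.three_mul_sum_closed (P := c.toFinset.image q) (fun y z hy hyz => by
    obtain ⟨i, hi, rfl⟩ := Finset.mem_image.1 hy
    have hi' := hcl i (by simpa using hi)
    rcases (hq.adj i hi'.1 z).1 hyz with e | e
    · rw [e]; exact Finset.mem_image_of_mem _ (by simpa using hi'.2.1)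
    · rw [e]; exact Finset.mem_image_of_mem _ (by simpa using hi'.2.2)) x
  rw [Finset.card_image_of_injOn hinj, List.toFinset_card_of_nodup hnd, Finset.sum_image hinj] at h1
  have h2 : ∑ i ∈ c.toFinset, I (q i) x = (c.countP (pointMask q I x).testBit : ℤ) := by
    rw [Finset.sum_congr rfl fun i hi => h.inc_eq x (hcl i (by simpa using hi)).1,
      List.countP_eq_length_filter, ← List.toFinset_card_of_nodup (hnd.filter _),
      List.toFinset_filter, Finset.card_filter]
    push_cast
    refine Finset.sum_congr rfl fun i _ => ?_
    cases (pointMask q I x).testBit i <;> simp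
  rw [h2] at h1
  exact_mod_cast h1

/-- The field `wave` is a digitwise identity a + b = c + d. For binary digits it means that the
exclusive ors agree, which gives `thirdMask`, and that the conjunctions agree, which is `isStep`. -/
theorem pointMask_step (ht : t < 3) (hκ : ∀ x y, κ x y = 0 ∨ κ x y = 1) {x y z : Fin 18}
    (hyz : y ≠ z) (hx : ∀ w, κ x w = 1 ↔ w = y ∨ w = z) :
    pointMask q I z = thirdMask t (pointMask q I x) (pointMask q I y) ∧
      isStep t (pointMask q I x) (pointMask q I y) = true := by
  have key : ∀ i, i < 9 → ((pointMask q I y).testBit i).toNat + ((pointMask q I z).testBit i).toNat =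
      ((pointMask q I x).testBit (nextIdx t i)).toNat +
      ((pointMask q I x).testBit (prevIdx t i)).toNat := by
    intro i hi
    obtain ⟨h1, h2, h3⟩ := nextIdx_prevIdx ht hi
    have hw := h.wave x (q i)
    rw [sum_mul_of_pair (hκ x) hyz hx, sum_mul_of_pair (h.graph_zero_or_one (q i))
      (fun e => h3 (hq.inj _ _ h1 h2 e)) (hq.adj i hi), h.inc_eq _ hi, h.inc_eq _ hi,
      h.inc_eq _ h1, h.inc_eq _ h2] at hw
    exact_mod_cast hw
  obtain ⟨hN, hP⟩ := nextMask_prevMask ht (ofDigits_lt 9 fun i => decide (I (q i) x = 1))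
  change nextMask t (pointMask q I x) = permMask _ (pointMask q I x) at hN
  change prevMask t (pointMask q I x) = permMask _ (pointMask q I x) at hP
  have hz : pointMask q I z = thirdMask t (pointMask q I x) (pointMask q I y) := by
    apply Nat.eq_of_testBit_eq
    intro i
    simp only [thirdMask, hN, hP, Nat.testBit_xor, testBit_permMask]
    by_cases hi : i < 9
    · have := key i hi
      revert this
      cases (pointMask q I y).testBit i <;> cases (pointMask q I z).testBit i <;>
      cases (pointMask q I x).testBit (nextIdx t i) <;>
      cases (pointMask q I x).testBit (prevIdx t i) <;> simp [hi]
    · simp [testBit_pointMask, hi]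
  refine ⟨hz, ?_⟩
  unfold isStep
  rw [← hz, hN, hP, Nat.beq_eq]
  apply Nat.eq_of_testBit_eq
  intro i
  simp only [Nat.testBit_and, testBit_permMask]
  by_cases hi : i < 9
  · have := key i hi
    revert this
    cases (pointMask q I y).testBit i <;> cases (pointMask q I z).testBit i <;>
    cases (pointMask q I x).testBit (nextIdx t i) <;>
    cases (pointMask q I x).testBit (prevIdx t i) <;> simp [hi]
  · simp [testBit_pointMask, hi]

theorem card_pair (ht : t < 3) {i j : ℕ} (hi : i < 9) (hj : j < 9) (hij : i ≠ j) :
    (Finset.univ.filter fun x => (pointMask q I x).testBit i = true ∧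
      (pointMask q I x).testBit j = true).card = interSize t i j := by
  obtain ⟨h1, h2, h3⟩ := nextIdx_prevIdx ht hi
  have hp := h.inter (q i) (q j)
  rw [if_neg fun e => hij (hq.inj _ _ hi hj e), graph_eq hq h.graph_zero_or_one ht hi hj,
    sum_mul_of_pair (h.graph_zero_or_one (q i)) (fun e => h3 (hq.inj _ _ h1 h2 e)) (hq.adj i hi),
    graph_eq hq h.graph_zero_or_one ht h1 hj, graph_eq hq h.graph_zero_or_one ht h2 hj] at hp
  have hs : ∑ x, I (q i) x * I (q j) x = ((Finset.univ.filter fun x =>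
      (pointMask q I x).testBit i = true ∧ (pointMask q I x).testBit j = true).card : ℤ) := by
    rw [Finset.card_filter]
    push_cast
    refine Finset.sum_congr rfl fun x _ => ?_
    rw [h.inc_eq x hi, h.inc_eq x hj]
    cases (pointMask q I x).testBit i <;> cases (pointMask q I x).testBit j <;> simp
  rw [hs] at hp
  unfold interSize
  omega

theorem sum_inc_mul (x x' : Fin 18) :
    ∑ y, I y x * I y x' = digitSum 9 (pointMask q I x &&& pointMask q I x') := by
  rw [hq.sum_eq, digitSum_eq_sum]
  push_cast
  refine Finset.sum_congr rfl fun i hi => ?_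
  have hi' := Finset.mem_range.1 hi
  rw [h.inc_eq x hi', h.inc_eq x' hi', Nat.testBit_and]
  cases (pointMask q I x).testBit i <;> cases (pointMask q I x').testBit i <;> simp

end IsHalf

/-! ### Masked configurations -/

/-- The labelled form of a configuration: every point `x` is given by two nine-digit masks. -/
structure IsMasked (t u : ℕ) (R : Fin 18 → Fin 18 → Prop) (S T : Fin 18 → ℕ) : Prop where
  regular : IsTwoRegular R
  left_mem : ∀ x, S x ∈ masks t
  right_mem : ∀ x, T x ∈ masks u
  left_step : ∀ {x y z}, y ≠ z → R x y → R x z →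
    S z = thirdMask t (S x) (S y) ∧ isStep t (S x) (S y) = true
  right_step : ∀ {x y z}, y ≠ z → R x y → R x z →
    T z = thirdMask u (T x) (T y) ∧ isStep u (T x) (T y) = true
  left_pair : ∀ {i j}, i < 9 → j < 9 → i ≠ j →
    (Finset.univ.filter fun x => (S x).testBit i = true ∧ (S x).testBit j = true).card =
      interSize t i j
  right_pair : ∀ {i j}, i < 9 → j < 9 → i ≠ j →
    (Finset.univ.filter fun x => (T x).testBit i = true ∧ (T x).testBit j = true).card =
      interSize u i j
  cross : ∀ {i j}, i < 9 → j < 9 →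
    (Finset.univ.filter fun x => (S x).testBit i = true ∧ (T x).testBit j = true).card = 2
  agree : ∀ {x y}, x ≠ y → digitSum 9 (S x &&& S y) + digitSum 9 (T x &&& T y) ≤ 2
  agree_adj : ∀ {x y}, R x y → digitSum 9 (S x &&& S y) + digitSum 9 (T x &&& T y) ≤ 1
  agree_common : ∀ {x y z}, y ≠ z → R x y → R x z →
    digitSum 9 (S y &&& S z) + digitSum 9 (T y &&& T z) ≤ 1
  agree_triangle : ∀ {x y z}, R x y → R y z → R x z →
    digitSum 9 (S x &&& S y) + digitSum 9 (T x &&& T y) = 0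

theorem IsMasked.swap {t u R S T} (h : IsMasked t u R S T) : IsMasked u t R T S where
  regular := h.regular
  left_mem := h.right_mem
  right_mem := h.left_mem
  left_step := h.right_step
  right_step := h.left_step
  left_pair := h.right_pair
  right_pair := h.left_pair
  cross hi hj := by
    rw [← h.cross hj hi]
    congr 1
    exact Finset.filter_congr fun x _ => and_comm
  agree hxy := by rw [add_comm]; exact h.agree hxy
  agree_adj hxy := by rw [add_comm]; exact h.agree_adj hxy
  agree_common hyz hxy hxz := by rw [add_comm]; exact h.agree_common hyz hxy hxz
  agree_triangle hxy hyz hxz := by rw [add_comm]; exact h.agree_triangle hxy hyz hxz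

/-- For distinct points, the number of common blocks in both halves, the entry of κ and the number
of common κ-neighbours add up to 2. Each bound on the agreement takes off what is known of the last
two terms. -/
theorem IsConfig.isMasked {κ D E I J} (h : IsConfig κ D E I J) {t u : ℕ} (ht : t < 3) (hu : u < 3)
    {q r : ℕ → Fin 9} (hq : IsLabelling t D q) (hr : IsLabelling u E r) :
    IsMasked t u (fun x y => κ x y = 1) (pointMask q I) (pointMask r J) := by
  have hreg : IsTwoRegular fun x y => κ x y = 1 :=
    { symm := fun {x y} hxy => by rw [h.comm]; exact hxy
      irrefl := fun x => by simp [h.self]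
      exists_pair := fun x => exists_pair_of_sum_eq_two (h.zero_or_one x) (h.regular x) }
  have hnn : ∀ x y, 0 ≤ κ x y := fun x y => by
    rcases h.zero_or_one x y with e | e <;> rw [e]; norm_num
  have hpair : ∀ {x y z}, y ≠ z → κ x y = 1 → κ x z = 1 → ∀ w, κ x w = 1 ↔ w = y ∨ w = z := by
    intro x y z hyz hy hz
    obtain ⟨a, b, hab, hw⟩ := exists_pair_of_sum_eq_two (h.zero_or_one x) (h.regular x)
    intro w
    rw [hw]
    rcases (hw y).1 hy with rfl | rfl <;> rcases (hw z).1 hz with rfl | rfl <;> tauto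
  have hagree : ∀ x y, x ≠ y → ((digitSum 9 (pointMask q I x &&& pointMask q I y) +
      digitSum 9 (pointMask r J x &&& pointMask r J y) : ℕ) : ℤ) + κ x y +
      ∑ t, κ x t * κ t y = 2 := by
    intro x y hxy
    have := h.agree x y
    rw [h.left.sum_inc_mul hq, h.right.sum_inc_mul hr, if_neg hxy] at this
    push_cast
    linarith
  have hcn0 : ∀ x y, 0 ≤ ∑ t, κ x t * κ t y := fun x y =>
    Finset.sum_nonneg fun _ _ => mul_nonneg (hnn _ _) (hnn _ _)
  have hcn1 : ∀ {x y z}, κ x y = 1 → κ x z = 1 → 1 ≤ ∑ t, κ y t * κ t z := by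
    intro x y z hy hz
    have h1 : κ y x * κ x z = 1 := by rw [h.comm y x, hy, hz]; norm_num
    rw [← h1]
    exact Finset.single_le_sum (f := fun t => κ y t * κ t z)
      (fun _ _ => mul_nonneg (hnn _ _) (hnn _ _)) (Finset.mem_univ x)
  refine ⟨hreg, h.left.pointMask_mem hq ht, h.right.pointMask_mem hr hu, ?_, ?_,
    h.left.card_pair hq ht, h.right.card_pair hr hu, ?_, ?_, ?_, ?_, ?_⟩
  · intro x y z hyz hy hz
    exact h.left.pointMask_step hq ht h.zero_or_one hyz (hpair hyz hy hz)
  · intro x y z hyz hy hz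
    exact h.right.pointMask_step hr hu h.zero_or_one hyz (hpair hyz hy hz)
  · intro i j hi hj
    have hs := h.cross (q i) (r j)
    have : ∑ x, I (q i) x * J (r j) x = ((Finset.univ.filter fun x =>
        (pointMask q I x).testBit i = true ∧ (pointMask r J x).testBit j = true).card : ℤ) := by
      rw [Finset.card_filter]
      push_cast
      refine Finset.sum_congr rfl fun x _ => ?_
      rw [h.left.inc_eq x hi, h.right.inc_eq x hj]
      cases (pointMask q I x).testBit i <;> cases (pointMask r J x).testBit j <;> simp
    rw [hs] at this
    exact_mod_cast this.symm
  · intro x y hxy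
    have h1 := hagree x y hxy
    have h2 := hcn0 x y
    have h3 := hnn x y
    omega
  · intro x y hxy
    have h1 := hagree x y (fun e => hreg.irrefl x (by rw [← e] at hxy; exact hxy))
    have h2 := hcn0 x y
    omega
  · intro x y z hyz hy hz
    have h1 := hagree y z hyz
    have h2 := hcn1 hy hz
    have h3 := hnn y z
    omega
  · intro x y z hxy hyz hxz
    have h1 := hagree x y (fun e => hreg.irrefl x (by rw [← e] at hxy; exact hxy))
    have h2 := hcn1 (hreg.symm hxz) (hreg.symm hyz)
    omega

/-! ### Counting digits, and local constraints on masks -/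

/-- Whether `x` has at most one binary digit `1`. -/
def atMostOne (x : ℕ) : Bool := Nat.beq (x &&& (x - 1)) 0

/-- Whether `x` has at most two binary digits `1`. -/
def atMostTwo (x : ℕ) : Bool := atMostOne (x &&& (x - 1))

theorem digitSum_pos {n x : ℕ} (hx : x < 2 ^ n) (h0 : x ≠ 0) : 1 ≤ digitSum n x := by
  by_contra hcon
  have h1 : digitSum n x = 0 := by omega
  rw [digitSum_eq_sum, Finset.sum_eq_zero_iff] at h1
  refine h0 (Nat.eq_of_testBit_eq fun i => ?_)
  rw [Nat.zero_testBit]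
  by_cases hi : i < n
  · simpa using h1 i (Finset.mem_range.2 hi)
  · exact Nat.testBit_lt_two_pow (lt_of_lt_of_le hx (Nat.pow_le_pow_right two_pos (by omega)))

/-- The conjunction of x and x - 1 is a submask of x and is smaller than x, so it has lost a digit.
-/
theorem digitSum_and_pred_lt {n x : ℕ} (hx : x < 2 ^ n) (h0 : x ≠ 0) :
    digitSum n (x &&& (x - 1)) < digitSum n x := by
  obtain ⟨i, hi⟩ : ∃ i, (x &&& (x - 1)).testBit i ≠ x.testBit i := by
    by_contra hcon
    push Not at hcon
    have h1 := Nat.eq_of_testBit_eq hcon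
    have h2 : x &&& (x - 1) ≤ x - 1 := Nat.and_le_right
    omega
  rw [digitSum_eq_sum, digitSum_eq_sum]
  have hle : ∀ j, ((x &&& (x - 1)).testBit j).toNat ≤ (x.testBit j).toNat := by
    intro j; rw [Nat.testBit_and]; cases x.testBit j <;> cases (x - 1).testBit j <;> simp
  have hlt : ((x &&& (x - 1)).testBit i).toNat < (x.testBit i).toNat := by
    revert hi; rw [Nat.testBit_and]
    cases x.testBit i <;> cases (x - 1).testBit i <;> simp
  have hin : i < n := by
    by_contra hin
    have : x.testBit i = false :=
      Nat.testBit_lt_two_pow (lt_of_lt_of_le hx (Nat.pow_le_pow_right two_pos (by omega)))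
    rw [this] at hlt; simp at hlt
  exact Finset.sum_lt_sum (fun j _ => hle j) ⟨i, Finset.mem_range.2 hin, hlt⟩

theorem atMostOne_of_digitSum_le {n x : ℕ} (hx : x < 2 ^ n) (h : digitSum n x ≤ 1) :
    atMostOne x = true := by
  unfold atMostOne
  rw [Nat.beq_eq]
  by_contra h0
  have hx0 : x ≠ 0 := by rintro rfl; simp at h0
  have h1 := digitSum_pos (lt_of_le_of_lt Nat.and_le_left hx) h0
  have h2 := digitSum_and_pred_lt hx hx0
  omega

theorem atMostTwo_of_digitSum_le {n x : ℕ} (hx : x < 2 ^ n) (h : digitSum n x ≤ 2) :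
    atMostTwo x = true := by
  by_cases hx0 : x = 0
  · subst hx0; rfl
  · exact atMostOne_of_digitSum_le (n := n) (lt_of_le_of_lt Nat.and_le_left hx)
      (by have := digitSum_and_pred_lt hx hx0; omega)

theorem testBit_word {a b : ℕ} (ha : a < 512) (i : ℕ) :
    (a + 512 * b).testBit i = if i < 9 then a.testBit i else b.testBit (i - 9) := by
  rw [add_comm]
  exact Nat.testBit_two_pow_mul_add (i := 9) b ha i

theorem digitSum_word {a b a' b' : ℕ} (ha : a < 512) (ha' : a' < 512) :
    digitSum 18 ((a + 512 * b) &&& (a' + 512 * b')) =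
      digitSum 9 (a &&& a') + digitSum 9 (b &&& b') := by
  rw [digitSum_eq_sum, digitSum_eq_sum, digitSum_eq_sum, show 18 = 9 + 9 from rfl,
    Finset.sum_range_add]
  congr 1
  · refine Finset.sum_congr rfl fun i hi => ?_
    have hi' := Finset.mem_range.1 hi
    rw [Nat.testBit_and, testBit_word ha, testBit_word ha', if_pos hi', if_pos hi', Nat.testBit_and]
  · refine Finset.sum_congr rfl fun i _ => ?_
    rw [Nat.testBit_and, testBit_word ha, testBit_word ha', if_neg (by omega), if_neg (by omega),
      Nat.testBit_and, Nat.add_sub_cancel_left]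

/-- The conditions on the masks `s`, `s'` of two points that are joined in the `2`-regular graph on
the points: they concern the masks of the other neighbours of both. -/
def validStep (t s s' : ℕ) : Bool :=
  isStep t s s' && isStep t s' s && atMostOne (s &&& s') && atMostOne (s &&& thirdMask t s s') &&
    atMostOne (s' &&& thirdMask t s' s)

/-- `s` contains two opposite vertices of the hexagon. -/
def hexOpposite (s : ℕ) : Bool := Nat.beq (s &&& 9) 9 || Nat.beq (s &&& 18) 18 || Nat.beq (s &&& 36) 36

/-- `s` contains two adjacent vertices of the hexagon. -/
def hexAdjacent (s : ℕ) : Bool :=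
  (List.range 6).any fun i => s.testBit i && s.testBit ((i + 1) % 6)

/-- `s` contains two vertices of the hexagon at distance two. -/
def hexSecond (s : ℕ) : Bool :=
  (List.range 6).any fun i => s.testBit i && s.testBit ((i + 2) % 6)

/-- `s` and `s'` belong to a partition into three masks `s`, `s'`, `s''` such that the shifts of `s`
add up to `s' + s''`. -/
def isPerfect (t s s' : ℕ) : Bool :=
  isStep t s s' && Nat.beq (s &&& s') 0 && Nat.beq (s &&& thirdMask t s s') 0 &&
    Nat.beq (s' &&& thirdMask t s s') 0

/-- The masks that belong to a partition as in `isPerfect`. -/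
def perfectMasks (t : ℕ) : List ℕ := (masks t).filter fun s => (masks t).any fun s' => isPerfect t s s'

theorem digitSum_masks :
    (List.range 3).all (fun t => (masks t).all fun s => Nat.beq (digitSum 9 s) 3) = true := by
  decide +kernel

/-- In a triangle the two shifts of a digit are the other two digits, so the shifts of s add up to
its complement. Hence s, s' and the third mask partition the digits, and this is symmetric in s and
s'. -/
theorem validStep_zero : (masks 0).all (fun s => (masks 0).all fun s' =>
    !validStep 0 s s' || Nat.beq (thirdMask 0 s' s) (thirdMask 0 s s')) = true := by
  decide +kernel

/-- The shifts of two opposite vertices also fill the rest of the hexagon. If s' is not an opposite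
pair itself, then `validStep` fails. -/
theorem validStep_opposite : ((masks 1).filter hexOpposite).all (fun s => (masks 1).all fun s' =>
    !validStep 1 s s' || Nat.beq (thirdMask 1 s' s) (thirdMask 1 s s')) = true := by
  decide +kernel

/-- If s is {0, 1} on the hexagon, its shifts add up to {5, 0, 1, 2}. A mask s' disjoint from s
would be {2, 5} there, and the third mask {0, 1} would agree with s twice. -/
theorem validStep_adjacent : ((masks 1).filter hexAdjacent).all (fun s => (masks 1).all fun s' =>
    !validStep 1 s s' || !Nat.beq (s &&& s') 0) = true := by
  decide +kernel

/-- The vertex between the two vertices of s occurs in both shifts, so it belongs to s' and to the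
third mask. -/
theorem validStep_second : ((masks 1).filter hexSecond).all (fun s => (masks 1).all fun s' =>
    !validStep 1 s s' || !Nat.beq (s' &&& thirdMask 1 s s') 0) = true := by
  decide +kernel

theorem hex_cases : (masks 1).all (fun s => hexOpposite s || hexAdjacent s || hexSecond s) = true := by
  decide +kernel

theorem hexOpposite_disjoint :
    (masks 1).all (fun s => !(Nat.beq (s &&& 9) 9 && Nat.beq (s &&& 18) 18)) = true := by
  decide +kernel

/-- Such a mask and its two shifts partition the digits. On 6+3 it is one of three opposite pairs
with one of three triangle vertices; on the nonagon it is a residue class modulo 3. -/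
theorem length_perfectMasks : (perfectMasks 1).length = 9 ∧ (perfectMasks 2).length = 3 := by
  decide +kernel

/-- The masks along a walk in the `2`-regular graph on the points. -/
def walkList (t : ℕ) : ℕ → ℕ → ℕ → List ℕ
  | 0, _, _ => []
  | n + 1, a, b => a :: walkList t n b (thirdMask t b a)

/-- Whether the walk with the initial masks `a`, `b` can be continued for `n` steps. -/
def isWalkable (t : ℕ) : ℕ → ℕ → ℕ → Bool
  | 0, _, _ => true
  | n + 1, a, b => isStep t b a && isWalkable t n b (thirdMask t b a)

/-- The mask sequences of length `9` along walks, for the `9`-cycle. -/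
def nonagonWalks : List (List ℕ) :=
  (masks 2).flatMap fun a => ((masks 2).filter fun b => isWalkable 2 7 a b).map fun b =>
    walkList 2 9 a b

/-- The bounds on the agreement of points on a walk. -/
def isCoherent : List ℕ → Bool
  | [] => true
  -- The next two letters belong to a κ-neighbour and to a point with a common κ-neighbour, which
  -- agree at most once. Equal letters are allowed later on, as the walk may close up before its
  -- ninth point.
  | a :: l => (l.take 2).all (fun b => atMostOne (a &&& b)) &&
      l.all (fun b => Nat.beq a b || atMostTwo (a &&& b)) && isCoherent l

/-- The coherent sequences of words whose first letter contains `m`. -/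
def nonagonPairs (m : ℕ) : List (List ℕ) :=
  (nonagonWalks.filter fun A => Nat.beq (A.headD 0 &&& m) m).flatMap fun A =>
    (nonagonWalks.map fun B => List.zipWith (fun a b => a + 512 * b) A B).filter isCoherent

/-- The numbers 3 and 5 are the digit sets {0, 1} and {0, 2}. Any two coherent walks starting at
points on these pairs of blocks contain different words that agree in three digits. -/
theorem nonagonPairs_incompatible : (nonagonPairs 3).all (fun l => (nonagonPairs 5).all fun l' =>
    l.any fun a => l'.any fun b => !(Nat.beq a b || atMostTwo (a &&& b))) = true := by
  decide +kernel

theorem walkList_eq_map {t : ℕ} {S : Fin 18 → ℕ} {p : ℕ → Fin 18}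
    (hstep : ∀ n, S (p (n + 2)) = thirdMask t (S (p (n + 1))) (S (p n))) (n k : ℕ) :
    walkList t n (S (p k)) (S (p (k + 1))) = (List.range n).map fun i => S (p (k + i)) := by
  induction n generalizing k with
  | zero => rfl
  | succ n ih =>
    rw [walkList, ← hstep, ih (k + 1), List.range_succ_eq_map, List.map_cons, List.map_map]
    congr 1
    refine List.map_congr_left fun i _ => ?_
    simp only [Function.comp_apply, Nat.succ_eq_add_one]
    congr 2; omega

theorem isWalkable_of_step {t : ℕ} {S : Fin 18 → ℕ} {p : ℕ → Fin 18}
    (hstep : ∀ n, S (p (n + 2)) = thirdMask t (S (p (n + 1))) (S (p n)) ∧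
      isStep t (S (p (n + 1))) (S (p n)) = true) (n k : ℕ) :
    isWalkable t n (S (p k)) (S (p (k + 1))) = true := by
  induction n generalizing k with
  | zero => rfl
  | succ n ih => rw [isWalkable, (hstep k).2, ← (hstep k).1, ih (k + 1)]; rfl

theorem isCoherent_map {f : ℕ → ℕ} (n k : ℕ)
    (h1 : ∀ i, atMostOne (f i &&& f (i + 1)) = true) (h2 : ∀ i, atMostOne (f i &&& f (i + 2)) = true)
    (h3 : ∀ i j, Nat.beq (f i) (f j) = true ∨ atMostTwo (f i &&& f j) = true) :
    isCoherent ((List.range n).map fun i => f (k + i)) = true := by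
  induction n generalizing k with
  | zero => rfl
  | succ n ih =>
    have e : ((List.range (n + 1)).map fun i => f (k + i)) =
        f k :: (List.range n).map fun i => f (k + 1 + i) := by
      rw [List.range_succ_eq_map, List.map_cons, List.map_map]
      congr 1
      refine List.map_congr_left fun i _ => ?_
      simp only [Function.comp_apply, Nat.succ_eq_add_one]
      congr 1; omega
    rw [e, isCoherent, ih (k + 1), Bool.and_true, Bool.and_eq_true, List.all_eq_true,
      List.all_eq_true]
    constructor
    · intro b hb
      rw [List.mem_take_iff_getElem] at hb
      obtain ⟨i, hi, rfl⟩ := hb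
      rw [List.getElem_map, List.getElem_range]
      have hi2 : i < 2 := by omega
      interval_cases i
      · exact h1 k
      · exact h2 k
    · intro b hb
      obtain ⟨i, -, rfl⟩ := List.mem_map.1 hb
      rw [Bool.or_eq_true]
      exact h3 _ _

namespace IsMasked

variable {t u : ℕ} {R : Fin 18 → Fin 18 → Prop} {S T : Fin 18 → ℕ} (h : IsMasked t u R S T)

include h

theorem left_lt (ht : t < 3) (x : Fin 18) : S x < 512 := lt_of_mem_masks ht (h.left_mem x)

/-- A mask has three digits, while distinct points agree at most twice. -/
theorem left_injective (ht : t < 3) : Function.Injective S := by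
  intro x y hxy
  by_contra hne
  have h1 := h.agree hne
  have h2 := digitSum_masks
  simp only [List.all_eq_true, List.mem_range, Nat.beq_eq] at h2
  rw [hxy, Nat.and_self, h2 t ht _ (h.left_mem y)] at h1
  omega

theorem exists_third {x y : Fin 18} (hxy : R x y) : ∃ z, y ≠ z ∧ R x z := by
  obtain ⟨z, hz, hw⟩ := h.regular.exists_other (h.regular.symm hxy)
  exact ⟨z, hz, (hw z).2 (Or.inr rfl)⟩

theorem validStep_left (ht : t < 3) {x y z w : Fin 18} (hyz : y ≠ z) (hxw : x ≠ w) (hxy : R x y)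
    (hxz : R x z) (hyw : R y w) : validStep t (S x) (S y) = true ∧
      S z = thirdMask t (S x) (S y) ∧ S w = thirdMask t (S y) (S x) := by
  obtain ⟨h1, h2⟩ := h.left_step hyz hxy hxz
  obtain ⟨h3, h4⟩ := h.left_step hxw (h.regular.symm hxy) hyw
  have key : ∀ {a b}, R a b → atMostOne (S a &&& S b) = true := by
    intro a b hab
    have := h.agree_adj hab
    exact atMostOne_of_digitSum_le (n := 9)
      (lt_of_le_of_lt Nat.and_le_left (h.left_lt ht a)) (by omega)
  refine ⟨?_, h1, h3⟩
  unfold validStep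
  rw [h2, h4, ← h1, ← h3, key hxy, key hxz, key hyw]
  rfl

/-- The other neighbour of x and the other neighbour of y get the same mask, so they are the same
point. -/
theorem triangle_of_forced (ht : t < 3) {x y z : Fin 18} (hyz : y ≠ z) (hxy : R x y) (hxz : R x z)
    (hf : validStep t (S x) (S y) = true →
      thirdMask t (S y) (S x) = thirdMask t (S x) (S y)) : R y z := by
  obtain ⟨w, hw, hyw⟩ := h.exists_third (h.regular.symm hxy)
  obtain ⟨h1, h2, h3⟩ := h.validStep_left ht hyz hw hxy hxz hyw
  have : S w = S z := by rw [h2, h3, hf h1]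
  rw [← h.left_injective ht this]
  exact hyw

theorem isPerfect_left (ht : t < 3) {x y z : Fin 18} (hneq : y ≠ z) (hxy : R x y) (hxz : R x z)
    (hyz : R y z) : isPerfect t (S x) (S y) = true ∧ S z = thirdMask t (S x) (S y) := by
  obtain ⟨h1, h2⟩ := h.left_step hneq hxy hxz
  have key : ∀ {a b c}, R a b → R b c → R a c → Nat.beq (S a &&& S b) 0 = true := by
    intro a b c hab hbc hac
    have h3 := h.agree_triangle hab hbc hac
    rw [Nat.beq_eq]
    by_contra h0
    have := digitSum_pos (n := 9) (lt_of_le_of_lt Nat.and_le_left (h.left_lt ht a)) h0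
    omega
  refine ⟨?_, h1⟩
  unfold isPerfect
  rw [h2, ← h1, key hxy hyz hxz, key hxz (h.regular.symm hyz) hxy,
    key hyz (h.regular.symm hxz) (h.regular.symm hxy)]
  rfl

theorem mem_perfectMasks (ht : t < 3) {x y z : Fin 18} (hneq : y ≠ z) (hxy : R x y) (hxz : R x z)
    (hyz : R y z) : S x ∈ perfectMasks t := by
  unfold perfectMasks
  rw [List.mem_filter, List.any_eq_true]
  exact ⟨h.left_mem x, S y, h.left_mem y, (h.isPerfect_left ht hneq hxy hxz hyz).1⟩

theorem card_le_of_triangles (ht : t < 3) (P : Finset (Fin 18))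
    (hP : ∀ x ∈ P, ∃ y z, y ≠ z ∧ R x y ∧ R x z ∧ R y z) : P.card ≤ (perfectMasks t).length := by
  have h1 : P.image S ⊆ (perfectMasks t).toFinset := by
    intro s hs
    obtain ⟨x, hx, rfl⟩ := Finset.mem_image.1 hs
    obtain ⟨y, z, hneq, hxy, hxz, hyz⟩ := hP x hx
    exact List.mem_toFinset.2 (h.mem_perfectMasks ht hneq hxy hxz hyz)
  calc P.card = (P.image S).card := (Finset.card_image_of_injective _ (h.left_injective ht)).symm
    _ ≤ (perfectMasks t).toFinset.card := Finset.card_le_card h1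
    _ ≤ _ := List.toFinset_card_le _

end IsMasked

/-! ### Excluding all but two pairs of types -/

theorem IsMasked.triangle_zero {u R S T} (h : IsMasked 0 u R S T) {x y z : Fin 18} (hyz : y ≠ z)
    (hxy : R x y) (hxz : R x z) : R y z := by
  refine h.triangle_of_forced (by norm_num) hyz hxy hxz fun hv => ?_
  have key := validStep_zero
  simp only [List.all_eq_true, Bool.or_eq_true, Bool.not_eq_true', Nat.beq_eq] at key
  exact (key _ (h.left_mem x) _ (h.left_mem y)).resolve_left (by simp [hv])

theorem IsMasked.triangle_opposite {u R S T} (h : IsMasked 1 u R S T) {x y z : Fin 18}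
    (hx : hexOpposite (S x) = true) (hyz : y ≠ z) (hxy : R x y) (hxz : R x z) : R y z := by
  refine h.triangle_of_forced (by norm_num) hyz hxy hxz fun hv => ?_
  have key := validStep_opposite
  simp only [List.all_eq_true, Bool.or_eq_true, Bool.not_eq_true', Nat.beq_eq] at key
  exact (key _ (List.mem_filter.2 ⟨h.left_mem x, hx⟩) _ (h.left_mem y)).resolve_left (by simp [hv])

/-- Every point lies in a triangle, so the other half needs 18 different perfect masks; the types
6+3 and 9 have only 9 and 3. -/
theorem IsMasked.eq_zero {u R S T} (h : IsMasked 0 u R S T) (hu : u < 3) : u = 0 := by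
  have h1 := h.swap.card_le_of_triangles hu Finset.univ fun x _ => by
    obtain ⟨y, z, hyz, hw⟩ := h.regular.exists_pair x
    have hy := (hw y).2 (Or.inl rfl)
    have hz := (hw z).2 (Or.inr rfl)
    exact ⟨y, z, hyz, hy, hz, h.triangle_zero hyz hy hz⟩
  rw [Finset.card_univ, Fintype.card_fin] at h1
  obtain ⟨h2, h3⟩ := length_perfectMasks
  interval_cases u
  · rfl
  · omega
  · omega

theorem and_eq_of_testBit {s i j : ℕ} (hi : s.testBit i = true) (hj : s.testBit j = true) :
    s &&& (2 ^ i ||| 2 ^ j) = 2 ^ i ||| 2 ^ j := by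
  apply Nat.eq_of_testBit_eq
  intro k
  rw [Nat.testBit_and, Nat.testBit_or, Nat.testBit_two_pow, Nat.testBit_two_pow]
  by_cases h1 : i = k
  · subst h1; simp [hi]
  by_cases h2 : j = k
  · subst h2; simp [hj]
  simp [h1, h2]

theorem testBit_of_and_eq {s i j : ℕ} (h : s &&& (2 ^ i ||| 2 ^ j) = 2 ^ i ||| 2 ^ j) :
    s.testBit i = true ∧ s.testBit j = true := by
  have key : ∀ k, (s.testBit k && (2 ^ i ||| 2 ^ j).testBit k) = (2 ^ i ||| 2 ^ j).testBit k :=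
    fun k => by rw [← Nat.testBit_and, h]
  constructor
  · have := key i; simpa [Nat.testBit_or, Nat.testBit_two_pow] using this
  · have := key j; simpa [Nat.testBit_or, Nat.testBit_two_pow] using this

/-- Opposite blocks of the hexagon meet in two points, and these lie in triangles. Two opposite
pairs give four points in triangles, more than the three perfect masks of the nonagon. -/
theorem IsMasked.one_two_false {R S T} (h : IsMasked 1 2 R S T) : False := by
  have hopp : ∀ {x i}, i < 3 → (S x).testBit i = true ∧ (S x).testBit (i + 3) = true →
      hexOpposite (S x) = true := by
    intro x i hi hx
    have h1 := and_eq_of_testBit hx.1 hx.2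
    unfold hexOpposite
    simp only [Bool.or_eq_true, Nat.beq_eq]
    interval_cases i
    · exact Or.inl (Or.inl h1)
    · exact Or.inl (Or.inr h1)
    · exact Or.inr h1
  set P := Finset.univ.filter fun x => (S x).testBit 0 = true ∧ (S x).testBit 3 = true with hP
  set Q := Finset.univ.filter fun x => (S x).testBit 1 = true ∧ (S x).testBit 4 = true with hQ
  have cP : P.card = 2 := h.left_pair (by norm_num) (by norm_num) (by norm_num)
  have cQ : Q.card = 2 := h.left_pair (by norm_num) (by norm_num) (by norm_num)
  have hdis : Disjoint P Q := by
    rw [Finset.disjoint_left]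
    intro x hx hx'
    have h1 := (Finset.mem_filter.1 hx).2
    have h2 := (Finset.mem_filter.1 hx').2
    have key := hexOpposite_disjoint
    rw [List.all_eq_true] at key
    have h3 := key _ (h.left_mem x)
    have e1 : S x &&& 9 = 9 := and_eq_of_testBit h1.1 h1.2
    have e2 : S x &&& 18 = 18 := and_eq_of_testBit h2.1 h2.2
    rw [e1, e2] at h3
    simp at h3
  have h1 := h.swap.card_le_of_triangles (by norm_num) (P ∪ Q) fun x hx => by
    obtain ⟨y, z, hyz, hw⟩ := h.regular.exists_pair x
    have hy := (hw y).2 (Or.inl rfl)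
    have hz := (hw z).2 (Or.inr rfl)
    refine ⟨y, z, hyz, hy, hz, h.triangle_opposite ?_ hyz hy hz⟩
    rcases Finset.mem_union.1 hx with hx | hx
    · exact hopp (i := 0) (by norm_num) (Finset.mem_filter.1 hx).2
    · exact hopp (i := 1) (by norm_num) (Finset.mem_filter.1 hx).2
  rw [Finset.card_union_of_disjoint hdis, cP, cQ, length_perfectMasks.2] at h1
  omega

theorem IsMasked.two_two_false {R S T} (h : IsMasked 2 2 R S T) : False := by
  have hlt := h.left_lt (by norm_num)
  have hlt' := h.swap.left_lt (by norm_num)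
  have hwlt : ∀ x, S x + 512 * T x < 2 ^ 18 := fun x => by have := hlt x; have := hlt' x; omega
  have hand : ∀ x y, (S x + 512 * T x) &&& (S y + 512 * T y) < 2 ^ 18 :=
    fun x y => lt_of_le_of_lt Nat.and_le_left (hwlt x)
  have h2 : ∀ x y, Nat.beq (S x + 512 * T x) (S y + 512 * T y) = true ∨
      atMostTwo ((S x + 512 * T x) &&& (S y + 512 * T y)) = true := by
    intro x y
    by_cases hxy : x = y
    · subst hxy; left; simp
    · right
      exact atMostTwo_of_digitSum_le (hand x y)
        (by rw [digitSum_word (hlt x) (hlt y)]; exact h.agree hxy)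
  have key : ∀ j, 0 < j → j < 3 → ∃ p : ℕ → Fin 18,
      ((List.range 9).map fun i => S (p (0 + i)) + 512 * T (p (0 + i))) ∈
        nonagonPairs (2 ^ 0 ||| 2 ^ j) := by
    intro j hj0 hj
    -- Blocks at distance one or two on the nonagon share exactly one point.
    have hex : (Finset.univ.filter fun x => (S x).testBit 0 = true ∧
        (S x).testBit j = true).Nonempty := by
      rw [← Finset.card_pos, h.left_pair (by norm_num) (by omega) (by omega)]
      interval_cases j <;> decide
    obtain ⟨x, hx⟩ := hex
    have hx' := (Finset.mem_filter.1 hx).2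
    obtain ⟨y, z, hyz, hw⟩ := h.regular.exists_pair x
    obtain ⟨p, hp0, hp1, hp⟩ := h.regular.exists_walk ((hw y).2 (Or.inl rfl))
    have hadj : ∀ n, R (p (n + 1)) (p n) ∧ R (p (n + 1)) (p (n + 2)) :=
      fun n => ⟨((hp n).2 _).2 (Or.inl rfl), ((hp n).2 _).2 (Or.inr rfl)⟩
    have hS : ∀ n, S (p (n + 2)) = thirdMask 2 (S (p (n + 1))) (S (p n)) ∧
        isStep 2 (S (p (n + 1))) (S (p n)) = true :=
      fun n => h.left_step (hp n).1 (hadj n).1 (hadj n).2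
    have hT : ∀ n, T (p (n + 2)) = thirdMask 2 (T (p (n + 1))) (T (p n)) ∧
        isStep 2 (T (p (n + 1))) (T (p n)) = true :=
      fun n => h.right_step (hp n).1 (hadj n).1 (hadj n).2
    -- Nine masks arise from the two initial ones by seven steps.
    have hmemS : ((List.range 9).map fun i => S (p (0 + i))) ∈ nonagonWalks := by
      rw [← walkList_eq_map (fun n => (hS n).1) 9 0]
      exact List.mem_flatMap.2 ⟨_, h.left_mem _, List.mem_map_of_mem
        (List.mem_filter.2 ⟨h.left_mem _, isWalkable_of_step hS 7 0⟩)⟩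
    have hmemT : ((List.range 9).map fun i => T (p (0 + i))) ∈ nonagonWalks := by
      rw [← walkList_eq_map (fun n => (hT n).1) 9 0]
      exact List.mem_flatMap.2 ⟨_, h.right_mem _, List.mem_map_of_mem
        (List.mem_filter.2 ⟨h.right_mem _, isWalkable_of_step hT 7 0⟩)⟩
    refine ⟨p, List.mem_flatMap.2 ⟨_, List.mem_filter.2 ⟨hmemS, ?_⟩,
      List.mem_filter.2 ⟨List.mem_map.2 ⟨_, hmemT, ?_⟩, ?_⟩⟩⟩
    · rw [Nat.beq_eq]
      change S (p (0 + 0)) &&& _ = _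
      rw [add_zero, hp0]
      exact and_eq_of_testBit hx'.1 hx'.2
    · rfl
    · refine isCoherent_map (f := fun i => S (p i) + 512 * T (p i)) 9 0 (fun i => ?_) (fun i => ?_)
        fun i j => h2 _ _
      · exact atMostOne_of_digitSum_le (hand _ _) (by
          rw [digitSum_word (hlt _) (hlt _)]
          exact h.agree_adj (h.regular.symm (hadj i).1))
      · exact atMostOne_of_digitSum_le (hand _ _) (by
          rw [digitSum_word (hlt _) (hlt _)]
          exact h.agree_common (hp i).1 (hadj i).1 (hadj i).2)
  obtain ⟨p, hp⟩ := key 1 (by norm_num) (by norm_num)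
  obtain ⟨r, hr⟩ := key 2 (by norm_num) (by norm_num)
  have h3 := nonagonPairs_incompatible
  rw [List.all_eq_true] at h3
  have h4 := h3 _ hp
  rw [List.all_eq_true] at h4
  have h5 := h4 _ hr
  rw [List.any_eq_true] at h5
  obtain ⟨a, ha, h6⟩ := h5
  rw [List.any_eq_true] at h6
  obtain ⟨b, hb, h7⟩ := h6
  obtain ⟨i, -, rfl⟩ := List.mem_map.1 ha
  obtain ⟨j, -, rfl⟩ := List.mem_map.1 hb
  have h8 := h2 (p (0 + i)) (r (0 + j))
  rw [← Bool.or_eq_true] at h8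
  rw [h8] at h7
  exact absurd h7 (by decide)

/-- Both halves have the same type, and it is not the `9`-cycle. -/
theorem IsMasked.types {t u R S T} (h : IsMasked t u R S T) (ht : t < 3) (hu : u < 3) :
    (t = 0 ∧ u = 0) ∨ (t = 1 ∧ u = 1) := by
  interval_cases t
  · exact Or.inl ⟨rfl, h.eq_zero hu⟩
  · interval_cases u
    · exact absurd (h.swap.eq_zero (by norm_num)) (by norm_num)
    · exact Or.inr ⟨rfl, rfl⟩
    · exact h.one_two_false.elim
  · interval_cases u
    · exact absurd (h.swap.eq_zero (by norm_num)) (by norm_num)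
    · exact h.swap.one_two_false.elim
    · exact h.two_two_false.elim

/-! ### The search and its results -/

/-- Whether two words of eighteen digits have at most two ones in common. -/
def compatible (a b : ℕ) : Bool := atMostTwo (a &&& b)

/-- Whether all ones of `m` are ones of `w`. -/
def covers (m w : ℕ) : Bool := Nat.beq (w &&& m) m

/-- Exhaustive search for a set of pairwise compatible words that contains `chosen`, and in which,
for `(m, d)` in `demands`, exactly `d` words cover `m`. At every stage `need` words still have to be
chosen from `hit` before the next demand is considered; `rest` holds the other words that are
available. Each result consists of a set of words and of the words left over. -/
def search : ℕ → List (ℕ × ℕ) → ℕ → List ℕ → List ℕ → List ℕ → List (List ℕ × List ℕ)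
  -- The nonempty second component marks exhausted fuel: `search_sound` then claims nothing, and
  -- `results_expected` shows that this does not occur.
  | 0, _, _, chosen, _, _ => [(chosen, [0])]
  | _ + 1, [], 0, chosen, _, rest => [(chosen, rest)]
  -- The old `hit` is dropped: when nothing is needed any more, it contains no further word of the
  -- configuration.
  | fuel + 1, (m, d) :: demands, 0, chosen, _, rest =>
    let k := chosen.countP (covers m)
    bif Nat.ble k d then
      search fuel demands (d - k) chosen (rest.filter (covers m)) (rest.filter fun w => !covers m w)
    else []
  | _ + 1, _, _ + 1, _, [], _ => []
  | fuel + 1, demands, need + 1, chosen, v :: hit, rest =>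
    search fuel demands need (v :: chosen) (hit.filter (compatible v)) (rest.filter (compatible v)) ++
      search fuel demands (need + 1) chosen hit rest

/-- The pairs of digits, with the number of points that have ones at both. -/
def demands (t : ℕ) : List (ℕ × ℕ) :=
  (List.range 18).flatMap fun i => ((List.range 18).filter fun j => Nat.blt i j).map fun j =>
    (2 ^ i ||| 2 ^ j,
      if j < 9 then interSize t i j else if i < 9 then 2 else interSize t (i - 9) (j - 9))

/-- The three words of a triangle of points, in standard position. -/
def baseWords : List ℕ := [73 + 512 * 73, 146 + 512 * 146, 292 + 512 * 292]

/-- The pairs of masks that are admissible for a point. -/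
def admissible (t a b : ℕ) : Bool :=
  match t with
  | 0 => true
  | _ => (hexOpposite a && hexOpposite b) || (hexAdjacent a && hexSecond b) ||
      (hexSecond a && hexAdjacent b)

/-- The words that are available next to the base words. -/
def candidates (t : ℕ) : List ℕ :=
  (masks t).flatMap fun a => ((((masks t).filter (admissible t a)).map fun b => a + 512 * b).filter
    fun w => baseWords.all (compatible w))

/-- The sets of words found by the search. -/
def results (t : ℕ) : List (List ℕ × List ℕ) :=
  search 1000 (demands t) 0 baseWords [] (candidates t)

/-- Adjacency in the `2`-regular graph on the points, in terms of the words `l` of all points. -/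
def pointAdj (t : ℕ) (l : List ℕ) (u v : ℕ) : Bool :=
  isStep t (u % 512) (v % 512) && isStep t (u / 512) (v / 512) &&
    l.any fun w => Nat.beq w
      (thirdMask t (u % 512) (v % 512) + 512 * thirdMask t (u / 512) (v / 512))

/-- Adjacency in the graph that belongs to the set `l` of words; the numbers below `18` stand for the
words, the other ones for the digits, with the digits from `9` on at last. -/
def codeAdj (t : ℕ) (l : List ℕ) (i j : ℕ) : Bool :=
  bif Nat.blt i 18 then
    bif Nat.blt j 18 then !Nat.beq i j && !pointAdj t l (l.getD i 0) (l.getD j 0)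
    -- The digits from 9 on record blocks of non-neighbours, hence the negation.
    else bif Nat.blt j 27 then (l.getD i 0).testBit (j - 18) else !(l.getD i 0).testBit (j - 18)
  else bif Nat.blt j 18 then
    bif Nat.blt i 27 then (l.getD j 0).testBit (i - 18) else !(l.getD j 0).testBit (i - 18)
  else bif Nat.blt i 27 then Nat.blt j 27 && Nat.beq (cycleAdj t (i - 18) (j - 18)) 1
  else !Nat.blt j 27 && Nat.beq (cycleAdj t (i - 27) (j - 27)) 1

/-- The graph on `Fin 36` whose adjacency matrix has the given rows, as binary numbers. -/
def rowsGraph (rows : List ℕ) : SimpleGraph (Fin 36) :=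
  SimpleGraph.fromRel fun i j => (rows.getD i 0).testBit j = true

/-- Whether `rows` is symmetric, with zero diagonal. -/
def isSymmetric (rows : List ℕ) : Bool :=
  (List.range 36).all fun i => !(rows.getD i 0).testBit i &&
    (List.range 36).all fun j => (rows.getD i 0).testBit j == (rows.getD j 0).testBit i

/-- Whether `p` is an isomorphism from the graph of the set `l` of words to the graph of `rows`. -/
def isIsomorphism (t : ℕ) (l rows p : List ℕ) : Bool :=
  (List.range 36).all fun i => Nat.blt (p.getD i 0) 36 && (List.range 36).all fun j =>
    (Nat.beq i j || !Nat.beq (p.getD i 0) (p.getD j 0)) &&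
      (rows.getD (p.getD i 0) 0).testBit (p.getD j 0) == codeAdj t l i j

/-- The rows of the two graphs. -/
def standardRows : ℕ → List ℕ
  | 0 => [
    49150148478, 33056619005, 55454201595, 50133721047, 57347927983, 55608860631, 32909291439,
    58456784766, 32013809403, 46593210877, 57655425533, 49837242107, 47048028079, 31562653655,
    29698277246, 58806534143, 49027776511, 29470261247, 1637376, 1377248, 917535, 12632856,
    10563718, 6425697, 100704837, 83970098, 50468232, 805531356, 671267763, 402773359,
    6442678069, 5368896238, 3221335515, 51539835723, 42949862902, 25769909949]
  | _ => [
    59370634234, 31048595437, 29685448666, 57605877623, 49817059053, 49194204635, 47002146751,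
    33089646455, 59260002031, 54661987807, 50139216894, 53624698813, 46609723255, 33857986239,
    31558973951, 58806534143, 49027776511, 29470261247, 8977408, 1393600, 2761272, 5280038,
    10553493, 4588619, 100712540, 83964419, 50466208, 4563623710, 671275763, 1342287598,
    2684582253, 5368887253, 2281825723, 51539834102, 42949864335, 25769910137]

/-- Isomorphisms from the graphs that are found by the search to the standard ones. -/
def isomorphisms : ℕ → List (List ℕ)
  | 0 => [
    [0, 1, 2, 3, 4, 5, 6, 7, 8, 9, 10, 11, 12, 13, 14, 15, 16, 17, 18, 19, 20, 21, 22, 23, 24,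
     25, 26, 27, 28, 29, 30, 31, 32, 33, 34, 35],
    [0, 1, 2, 3, 4, 5, 6, 7, 8, 9, 10, 11, 12, 13, 14, 15, 16, 17, 18, 19, 20, 21, 22, 23, 24,
     25, 26, 27, 28, 29, 33, 34, 35, 30, 31, 32],
    [0, 1, 2, 3, 4, 5, 6, 7, 8, 9, 10, 11, 12, 13, 14, 15, 16, 17, 18, 19, 20, 21, 22, 23, 24,
     25, 26, 30, 31, 32, 27, 28, 29, 33, 34, 35],
    [0, 1, 2, 3, 4, 5, 6, 7, 8, 9, 10, 11, 12, 13, 14, 15, 16, 17, 18, 19, 20, 21, 22, 23, 24,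
     25, 26, 33, 34, 35, 27, 28, 29, 30, 31, 32],
    [0, 1, 2, 3, 4, 5, 6, 7, 8, 9, 10, 11, 12, 13, 14, 15, 16, 17, 18, 19, 20, 21, 22, 23, 24,
     25, 26, 30, 31, 32, 33, 34, 35, 27, 28, 29],
    [0, 1, 2, 3, 4, 5, 6, 7, 8, 9, 10, 11, 12, 13, 14, 15, 16, 17, 18, 19, 20, 21, 22, 23, 24,
     25, 26, 33, 34, 35, 30, 31, 32, 27, 28, 29],
    [2, 4, 3, 0, 17, 16, 7, 8, 5, 6, 13, 12, 14, 15, 11, 10, 9, 1, 18, 19, 20, 23, 21, 22, 26,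
     24, 25, 33, 34, 35, 28, 29, 27, 31, 32, 30],
    [2, 4, 3, 0, 17, 16, 7, 8, 5, 6, 13, 12, 14, 15, 11, 10, 9, 1, 18, 19, 20, 23, 21, 22, 26,
     24, 25, 28, 29, 27, 33, 34, 35, 31, 32, 30],
    [2, 4, 3, 0, 17, 16, 7, 8, 5, 6, 13, 12, 14, 15, 11, 10, 9, 1, 18, 19, 20, 23, 21, 22, 26,
     24, 25, 33, 34, 35, 31, 32, 30, 28, 29, 27],
    [2, 4, 3, 0, 17, 16, 7, 8, 5, 6, 13, 12, 14, 15, 11, 10, 9, 1, 18, 19, 20, 23, 21, 22, 26,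
     24, 25, 28, 29, 27, 31, 32, 30, 33, 34, 35],
    [2, 4, 3, 0, 17, 16, 7, 8, 5, 6, 13, 12, 14, 15, 11, 10, 9, 1, 18, 19, 20, 23, 21, 22, 26,
     24, 25, 31, 32, 30, 33, 34, 35, 28, 29, 27],
    [2, 4, 3, 0, 17, 16, 7, 8, 5, 6, 13, 12, 14, 15, 11, 10, 9, 1, 18, 19, 20, 23, 21, 22, 26,
     24, 25, 31, 32, 30, 28, 29, 27, 33, 34, 35]]
  | _ => [
    [0, 1, 2, 3, 4, 5, 6, 7, 8, 9, 10, 11, 12, 13, 14, 15, 16, 17, 18, 19, 20, 21, 22, 23, 24,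
     25, 26, 27, 28, 29, 30, 31, 32, 33, 34, 35],
    [0, 1, 2, 3, 4, 5, 6, 7, 8, 9, 10, 11, 12, 13, 14, 15, 16, 17, 18, 19, 20, 21, 22, 23, 24,
     25, 26, 30, 31, 32, 27, 28, 29, 33, 34, 35],
    [9, 8, 5, 7, 4, 2, 6, 3, 1, 0, 14, 13, 12, 11, 10, 15, 17, 16, 18, 23, 22, 21, 20, 19, 24,
     26, 25, 30, 29, 28, 27, 32, 31, 33, 35, 34],
    [9, 8, 5, 7, 4, 2, 6, 3, 1, 0, 14, 13, 12, 11, 10, 15, 17, 16, 18, 23, 22, 21, 20, 19, 24,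
     26, 25, 27, 32, 31, 30, 29, 28, 33, 35, 34],
    [0, 1, 2, 17, 4, 5, 6, 16, 8, 9, 10, 11, 15, 13, 14, 12, 7, 3, 18, 19, 20, 21, 22, 23, 25,
     26, 24, 29, 30, 31, 32, 27, 28, 34, 35, 33],
    [9, 8, 5, 16, 4, 2, 6, 17, 1, 0, 14, 13, 15, 11, 10, 12, 3, 7, 18, 23, 22, 21, 20, 19, 25,
     24, 26, 32, 31, 30, 29, 28, 27, 34, 33, 35],
    [9, 8, 5, 16, 4, 2, 6, 17, 1, 0, 14, 13, 15, 11, 10, 12, 3, 7, 18, 23, 22, 21, 20, 19, 25,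
     24, 26, 29, 28, 27, 32, 31, 30, 34, 33, 35],
    [0, 1, 2, 17, 4, 5, 6, 16, 8, 9, 10, 11, 15, 13, 14, 12, 7, 3, 18, 19, 20, 21, 22, 23, 25,
     26, 24, 32, 27, 28, 29, 30, 31, 34, 35, 33]]

/-- Whether a set of words either does not come from a configuration, or gives a graph that is
isomorphic to the standard one. -/
def isExpected (t : ℕ) (l : List ℕ) : Bool :=
  Nat.beq l.length 18 && (l.any (fun u => Nat.blt (l.countP (pointAdj t l u)) 2) ||
    (l.all (fun u => Nat.beq (l.countP (pointAdj t l u)) 2) &&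
      (isomorphisms t).any (isIsomorphism t l (standardRows t))))

/-- This finite computation completes the classification: each family of words that is found either
cannot carry a 2-regular graph on its points or gives a standard graph. -/
theorem results_expected (t : ℕ) (ht : t < 2) :
    (results t).all (fun r => r.2.isEmpty && isExpected t r.1) = true := by
  have h : (List.range 2).all (fun t =>
      (results t).all fun r => r.2.isEmpty && isExpected t r.1) = true := by
    decide +kernel
  exact List.all_eq_true.1 h t (List.mem_range.2 ht)

theorem isSymmetric_standardRows (t : ℕ) (ht : t < 2) : isSymmetric (standardRows t) = true := by
  have h : (List.range 2).all (fun t => isSymmetric (standardRows t)) = true := by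
    decide +kernel
  exact List.all_eq_true.1 h t (List.mem_range.2 ht)

/-! ### Soundness of the search -/

/-- `l` lists the values of `w`, each of them once. -/
def IsListing (w : Fin 18 → ℕ) (l : List ℕ) : Prop :=
  l.Nodup ∧ (∀ v ∈ l, ∃ x, w x = v) ∧ ∀ x, w x ∈ l

/-- The invariant of `search`. -/
structure SearchInv (w : Fin 18 → ℕ) (need : ℕ) (chosen hit rest : List ℕ) : Prop where
  nodup : chosen.Nodup
  range : ∀ v ∈ chosen, ∃ x, w x = v
  cover : ∀ x, w x ∈ chosen ∨ w x ∈ hit ∨ w x ∈ rest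
  count : (Finset.univ.filter fun x => w x ∉ chosen ∧ w x ∈ hit).card = need

theorem card_filter_mem {w : Fin 18 → ℕ} (hw : Function.Injective w) {l : List ℕ} (hl : l.Nodup)
    (hr : ∀ v ∈ l, ∃ x, w x = v) (P : ℕ → Bool) :
    (Finset.univ.filter fun x => w x ∈ l ∧ P (w x) = true).card = l.countP P := by
  rw [List.countP_eq_length_filter, ← List.toFinset_card_of_nodup (hl.filter P),
    ← Finset.card_image_of_injective _ hw]
  congr 1
  ext v
  simp only [Finset.mem_image, Finset.mem_filter, Finset.mem_univ, true_and, List.mem_toFinset,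
    List.mem_filter]
  constructor
  · rintro ⟨x, hx, rfl⟩; exact hx
  · rintro ⟨h1, h2⟩
    obtain ⟨x, rfl⟩ := hr v h1
    exact ⟨x, ⟨h1, h2⟩, rfl⟩

/-- In the search tree, follow the branch that selects v exactly when v is a word of the
configuration not chosen before. The invariant is kept along this branch: compatibility filters
discard no true word, and the demands give the number of words still needed. -/
theorem search_sound {w : Fin 18 → ℕ} (hw : Function.Injective w)
    (hc : ∀ x y, x ≠ y → compatible (w x) (w y) = true) (fuel : ℕ) :
    ∀ (dem : List (ℕ × ℕ)) (need : ℕ) (chosen hit rest : List ℕ),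
    (∀ md ∈ dem, (Finset.univ.filter fun x => covers md.1 (w x) = true).card = md.2) →
    SearchInv w need chosen hit rest →
    ∃ r ∈ search fuel dem need chosen hit rest, r.2 = [] → IsListing w r.1 := by
  induction fuel with
  | zero =>
    intro dem need chosen hit rest _ _
    exact ⟨(chosen, [0]), by simp [search], by simp⟩
  | succ fuel ih =>
    intro dem need chosen hit rest hd hinv
    match need, dem, hit with
    | 0, [], hit =>
      refine ⟨(chosen, rest), by simp [search], fun h0 => ⟨hinv.nodup, hinv.range, fun x => ?_⟩⟩
      have h1 := Finset.card_eq_zero.1 hinv.count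
      rw [Finset.filter_eq_empty_iff] at h1
      have h2 := h1 (Finset.mem_univ x)
      rcases hinv.cover x with h | h | h
      · exact h
      · by_contra hn; exact h2 ⟨hn, h⟩
      · simp only at h0
        rw [h0] at h; simp at h
    | 0, (m, d) :: dem, hit =>
      have h1 := Finset.card_eq_zero.1 hinv.count
      rw [Finset.filter_eq_empty_iff] at h1
      have hcov : ∀ x, w x ∈ chosen ∨ w x ∈ rest := by
        intro x
        rcases hinv.cover x with h | h | h
        · exact Or.inl h
        · left; by_contra hn; exact h1 (Finset.mem_univ x) ⟨hn, h⟩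
        · exact Or.inr h
      have hm := hd (m, d) List.mem_cons_self
      simp only at hm
      have hk := card_filter_mem hw hinv.nodup hinv.range (covers m)
      have hsplit : (Finset.univ.filter fun x => covers m (w x) = true).card =
          (Finset.univ.filter fun x => w x ∈ chosen ∧ covers m (w x) = true).card +
          (Finset.univ.filter fun x => w x ∉ chosen ∧ w x ∈ rest.filter (covers m)).card := by
        rw [← Finset.card_union_of_disjoint]
        · congr 1
          ext x
          simp only [Finset.mem_filter, Finset.mem_univ, true_and, Finset.mem_union, List.mem_filter]
          have := hcov x
          tauto
        · rw [Finset.disjoint_left]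
          intro x hx hx'
          exact (Finset.mem_filter.1 hx').2.1 (Finset.mem_filter.1 hx).2.1
      have hle : Nat.ble (chosen.countP (covers m)) d = true := by
        rw [Nat.ble_eq]; omega
      obtain ⟨r, hr, hr2⟩ := ih dem (d - chosen.countP (covers m)) chosen (rest.filter (covers m))
        (rest.filter fun w => !covers m w) (fun md hmd => hd md (List.mem_cons_of_mem _ hmd))
        { nodup := hinv.nodup
          range := hinv.range
          cover := fun x => by
            rcases hcov x with h | h
            · exact Or.inl h
            · right
              simp only [List.mem_filter]
              cases covers m (w x) <;> simp [h]
          count := by omega }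
      refine ⟨r, ?_, hr2⟩
      rw [search]
      simp only [hle, cond_true]
      exact hr
    | need + 1, dem, [] =>
      have := hinv.count
      simp at this
    | need + 1, dem, v :: hit =>
      by_cases hv : v ∉ chosen ∧ ∃ x, w x = v
      · obtain ⟨hv, x, rfl⟩ := hv
        have hset : (Finset.univ.filter fun y => w y ∉ chosen ∧ w y ∈ w x :: hit) =
            insert x (Finset.univ.filter fun y => w y ∉ w x :: chosen ∧
              w y ∈ hit.filter (compatible (w x))) := by
          ext y
          simp only [Finset.mem_filter, Finset.mem_univ, true_and, List.mem_cons, Finset.mem_insert,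
            List.mem_filter]
          by_cases hxy : y = x
          · subst hxy; simp [hv]
          · have h1 : w y ≠ w x := fun e => hxy (hw e)
            have h2 := hc x y (Ne.symm hxy)
            simp [hxy, h1, h2]
        have hcount := hinv.count
        rw [hset, Finset.card_insert_of_notMem (by simp)] at hcount
        obtain ⟨r, hr, hr2⟩ := ih dem need (w x :: chosen) (hit.filter (compatible (w x)))
          (rest.filter (compatible (w x))) hd
          { nodup := List.nodup_cons.2 ⟨hv, hinv.nodup⟩
            range := fun u hu => by
              rcases List.mem_cons.1 hu with rfl | hu
              · exact ⟨x, rfl⟩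
              · exact hinv.range u hu
            cover := fun y => by
              by_cases hxy : y = x
              · subst hxy; simp
              · have h1 : w y ≠ w x := fun e => hxy (hw e)
                have h2 := hc x y (Ne.symm hxy)
                have h3 := hinv.cover y
                simp only [List.mem_cons, List.mem_filter, h1, false_or, h2, and_true] at h3 ⊢
                exact h3
            count := by omega }
        refine ⟨r, ?_, hr2⟩
        rw [search]
        exact List.mem_append_left _ hr
      · have hset : (Finset.univ.filter fun y => w y ∉ chosen ∧ w y ∈ v :: hit) =
            (Finset.univ.filter fun y => w y ∉ chosen ∧ w y ∈ hit) := by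
          ext y
          simp only [Finset.mem_filter, Finset.mem_univ, true_and, List.mem_cons]
          constructor
          · rintro ⟨h1, h2 | h2⟩
            · exact absurd ⟨h2 ▸ h1, y, h2⟩ hv
            · exact ⟨h1, h2⟩
          · rintro ⟨h1, h2⟩; exact ⟨h1, Or.inr h2⟩
        obtain ⟨r, hr, hr2⟩ := ih dem (need + 1) chosen hit rest hd
          { nodup := hinv.nodup
            range := hinv.range
            cover := fun y => by
              rcases hinv.cover y with h | h | h
              · exact Or.inl h
              · rcases List.mem_cons.1 h with h | h
                · left; by_contra hn; exact hv ⟨h ▸ hn, y, h⟩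
                · exact Or.inr (Or.inl h)
              · exact Or.inr (Or.inr h)
            count := by rw [← hset]; exact hinv.count }
        refine ⟨r, ?_, hr2⟩
        rw [search]
        exact List.mem_append_right _ hr

theorem covers_iff {i j w : ℕ} :
    covers (2 ^ i ||| 2 ^ j) w = true ↔ w.testBit i = true ∧ w.testBit j = true := by
  unfold covers
  rw [Nat.beq_eq]
  exact ⟨testBit_of_and_eq, fun h => and_eq_of_testBit h.1 h.2⟩

/-! ### Listing the words of a configuration -/

namespace IsMasked

/-- An adjacent pair in the hexagon costs an agreement between x and its neighbour y, and a pair at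
distance two costs one between the neighbours y and z. Both budgets are 1, so the halves cannot both
have adjacent pairs, nor both pairs at distance two. An opposite pair makes x, y, z a triangle,
where no agreement is allowed, so the other half has an opposite pair as well. -/
theorem admissible_one {R : Fin 18 → Fin 18 → Prop} {S T : Fin 18 → ℕ} (h : IsMasked 1 1 R S T)
    (x : Fin 18) : admissible 1 (S x) (T x) = true := by
  obtain ⟨y, z, hyz, hw⟩ := h.regular.exists_pair x
  have hy := (hw y).2 (Or.inl rfl)
  have hz := (hw z).2 (Or.inr rfl)
  obtain ⟨w, hxw, hyw⟩ := h.exists_third (h.regular.symm hy)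
  have hpos : ∀ {S T : Fin 18 → ℕ}, IsMasked 1 1 R S T → ∀ a b, Nat.beq (S a &&& S b) 0 = false →
      1 ≤ digitSum 9 (S a &&& S b) := by
    intro S T h a b hab
    refine digitSum_pos (n := 9)
      (lt_of_le_of_lt Nat.and_le_left (h.left_lt (by norm_num) a)) fun e => ?_
    rw [e] at hab; exact absurd hab (by decide)
  have hadj : ∀ {S T : Fin 18 → ℕ}, IsMasked 1 1 R S T → hexAdjacent (S x) = true →
      1 ≤ digitSum 9 (S x &&& S y) := by
    intro S T h hx
    have key := validStep_adjacent
    simp only [List.all_eq_true, Bool.or_eq_true, Bool.not_eq_true'] at key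
    exact hpos h _ _ ((key _ (List.mem_filter.2 ⟨h.left_mem x, hx⟩) _ (h.left_mem y)).resolve_left
      (by simp [(h.validStep_left (by norm_num) hyz hxw hy hz hyw).1]))
  have hsec : ∀ {S T : Fin 18 → ℕ}, IsMasked 1 1 R S T → hexSecond (S x) = true →
      1 ≤ digitSum 9 (S y &&& S z) := by
    intro S T h hx
    have key := validStep_second
    simp only [List.all_eq_true, Bool.or_eq_true, Bool.not_eq_true'] at key
    obtain ⟨h1, h2, -⟩ := h.validStep_left (by norm_num) hyz hxw hy hz hyw
    refine hpos h _ _ ?_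
    rw [h2]
    exact (key _ (List.mem_filter.2 ⟨h.left_mem x, hx⟩) _ (h.left_mem y)).resolve_left (by simp [h1])
  have hcases : ∀ {S T : Fin 18 → ℕ}, IsMasked 1 1 R S T →
      hexOpposite (S x) = true ∨ hexAdjacent (S x) = true ∨ hexSecond (S x) = true := by
    intro S T h
    have key := hex_cases
    simp only [List.all_eq_true, Bool.or_eq_true] at key
    have := key _ (h.left_mem x)
    tauto
  have hopp : ∀ {S T : Fin 18 → ℕ}, IsMasked 1 1 R S T → hexOpposite (S x) = true →
      digitSum 9 (T x &&& T y) = 0 ∧ digitSum 9 (T y &&& T z) = 0 := by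
    intro S T h hx
    have htri := h.triangle_opposite hx hyz hy hz
    have h1 := h.agree_triangle hy htri hz
    have h2 := h.agree_triangle htri (h.regular.symm hz) (h.regular.symm hy)
    omega
  have a1 := h.agree_adj hy
  have a2 := h.agree_common hyz hy hz
  unfold admissible
  simp only [Bool.or_eq_true, Bool.and_eq_true]
  rcases hcases h with hS | hS | hS <;> rcases hcases h.swap with hT | hT | hT
  · exact Or.inl (Or.inl ⟨hS, hT⟩)
  · have := (hopp h hS).1; have := hadj h.swap hT; omega
  · have := (hopp h hS).2; have := hsec h.swap hT; omega
  · have := (hopp h.swap hT).1; have := hadj h hS; omega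
  · have := hadj h hS; have := hadj h.swap hT; omega
  · exact Or.inl (Or.inr ⟨hS, hT⟩)
  · have := (hopp h.swap hT).2; have := hsec h hS; omega
  · exact Or.inr ⟨hS, hT⟩
  · have := hsec h hS; have := hsec h.swap hT; omega

variable {t : ℕ} {R : Fin 18 → Fin 18 → Prop} {S T : Fin 18 → ℕ} (h : IsMasked t t R S T)

include h

theorem word_injective (ht : t < 3) : Function.Injective fun x => S x + 512 * T x := by
  intro x y hxy
  have h1 := h.left_lt ht x
  have h2 := h.left_lt ht y
  simp only at hxy
  exact h.left_injective ht (by omega)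

/-- The pair counts `left_pair`, `cross` and `right_pair` are the demands of the search, and the
bound `agree` is the compatibility of words. -/
theorem exists_listing (ht : t < 2) (hb : ∀ v ∈ baseWords, ∃ x, S x + 512 * T x = v) :
    ∃ l, isExpected t l = true ∧ IsListing (fun x => S x + 512 * T x) l := by
  have hlt := h.left_lt (by omega)
  have hlt' := h.swap.left_lt (by omega)
  have hcomp : ∀ x y, x ≠ y → compatible (S x + 512 * T x) (S y + 512 * T y) = true := by
    intro x y hxy
    refine atMostTwo_of_digitSum_le (n := 18) (lt_of_le_of_lt Nat.and_le_left ?_) ?_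
    · have := hlt x; have := hlt' x; omega
    · rw [digitSum_word (hlt x) (hlt y)]; exact h.agree hxy
  have hdem : ∀ md ∈ demands t,
      (Finset.univ.filter fun x => covers md.1 (S x + 512 * T x) = true).card = md.2 := by
    intro md hmd
    unfold demands at hmd
    obtain ⟨i, hi, hmd⟩ := List.mem_flatMap.1 hmd
    obtain ⟨j, hj, rfl⟩ := List.mem_map.1 hmd
    obtain ⟨hj, hij⟩ := List.mem_filter.1 hj
    rw [List.mem_range] at hi hj
    rw [Nat.blt_eq] at hij
    simp only [covers_iff]
    by_cases hj9 : j < 9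
    · rw [if_pos hj9, ← h.left_pair (by omega : i < 9) hj9 (by omega)]
      congr 1
      refine Finset.filter_congr fun x _ => ?_
      rw [testBit_word (hlt x), testBit_word (hlt x), if_pos (by omega), if_pos hj9]
    rw [if_neg hj9]
    by_cases hi9 : i < 9
    · rw [if_pos hi9, ← h.cross hi9 (by omega : j - 9 < 9)]
      congr 1
      refine Finset.filter_congr fun x _ => ?_
      rw [testBit_word (hlt x), testBit_word (hlt x), if_pos hi9, if_neg hj9]
    · rw [if_neg hi9, ← h.right_pair (by omega : i - 9 < 9) (by omega : j - 9 < 9) (by omega)]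
      congr 1
      refine Finset.filter_congr fun x _ => ?_
      rw [testBit_word (hlt x), testBit_word (hlt x), if_neg hi9, if_neg hj9]
  obtain ⟨r, hr, hr2⟩ := search_sound (h.word_injective (by omega)) hcomp 1000 (demands t) 0
    baseWords [] (candidates t) hdem
    { nodup := by decide
      range := hb
      cover := fun x => by
        by_cases hx : S x + 512 * T x ∈ baseWords
        · exact Or.inl hx
        right; right
        unfold candidates
        refine List.mem_flatMap.2 ⟨S x, h.left_mem x, List.mem_filter.2 ⟨List.mem_map.2 ⟨T x,
          List.mem_filter.2 ⟨h.right_mem x, ?_⟩, rfl⟩, ?_⟩⟩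
        · interval_cases t
          · rfl
          · exact h.admissible_one x
        · rw [List.all_eq_true]
          intro v hv
          obtain ⟨y, rfl⟩ := hb v hv
          exact hcomp x y fun e => hx (by rw [e]; exact hv)
      count := by simp }
  have h1 := List.all_eq_true.1 (results_expected t ht) r hr
  rw [Bool.and_eq_true, List.isEmpty_iff] at h1
  exact ⟨r.1, h1.2, hr2 h1.1⟩

end IsMasked

/-! ### Moving a triangle of points into standard position -/

/-- The digit of the component of the triangle `3 * k, …, 3 * k + 2` in the mask `s`. -/
def triangleDigit (k s : ℕ) : ℕ :=
  bif s.testBit (3 * k) then 3 * k else bif s.testBit (3 * k + 1) then 3 * k + 1 else 3 * k + 2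

/-- The digit of `i` in the relabelling that moves the partition given by `s` and `s'` to the
standard one. -/
def normalizer (t s s' i : ℕ) : ℕ :=
  let k := triangleDigit 0 s
  let m := bif Nat.beq (i % 3) 0 then s else bif Nat.beq (i % 3) 1 then s' else thirdMask t s s'
  match t with
  | 0 => triangleDigit (i / 3) m
  | _ => bif Nat.blt i 6 then
      -- The opposite pair of `s` is {k, k + 3}. A rotation serves if `s'` contains k + 1, and a
      -- reflection otherwise.
      bif s'.testBit ((k + 1) % 6) then (k + i) % 6 else (k + 6 - i) % 6
    else triangleDigit 2 m

/-- Whether `p` is an automorphism of the standard union of cycles that moves the partition given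
by `s` and `s'` to the standard one. -/
def isNormalizer (t s s' : ℕ) (p : ℕ → ℕ) : Bool :=
  ((List.range 9).all fun i => Nat.blt (p i) 9 &&
    (Nat.beq (p (nextIdx t i)) (nextIdx t (p i)) && Nat.beq (p (prevIdx t i)) (prevIdx t (p i)) ||
      Nat.beq (p (nextIdx t i)) (prevIdx t (p i)) && Nat.beq (p (prevIdx t i)) (nextIdx t (p i))) &&
    (List.range 9).all fun j => Nat.beq i j || !Nat.beq (p i) (p j)) &&
  Nat.beq (permMask p s) 73 && Nat.beq (permMask p s') 146 &&
    Nat.beq (permMask p (thirdMask t s s')) 292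

/-- A perfect partition takes one vertex of each triangle into each class, and cuts a hexagon into
its three opposite pairs. Rotations and reflections act on each cycle separately and realise every
order of the classes. -/
theorem isNormalizer_normalizer {t s s' : ℕ} (ht : t < 2) (hs : s ∈ masks t) (hs' : s' ∈ masks t)
    (h : isPerfect t s s' = true) (h' : isPerfect t s' s = true) :
    isNormalizer t s s' (normalizer t s s') = true := by
  have key : (List.range 2).all (fun t => (masks t).all fun s => (masks t).all fun s' =>
      !(isPerfect t s s' && isPerfect t s' s) || isNormalizer t s s' (normalizer t s s')) = true := by
    decide +kernel
  simp only [List.all_eq_true, List.mem_range, Bool.or_eq_true, Bool.not_eq_true'] at key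
  exact (key t ht s hs s' hs').resolve_left (by simp [h, h'])

theorem pointMask_comp {p : ℕ → ℕ} (hp : ∀ i, i < 9 → p i < 9) (q : ℕ → Fin 9)
    (I : Fin 9 → Fin 18 → ℤ) (x : Fin 18) :
    pointMask (q ∘ p) I x = permMask p (pointMask q I x) := by
  apply Nat.eq_of_testBit_eq
  intro i
  rw [testBit_pointMask, testBit_permMask, testBit_pointMask]
  by_cases hi : i < 9
  · simp [hi, hp i hi]
  · simp [hi]

theorem IsLabelling.comp {t s s' : ℕ} {D : Fin 9 → Fin 9 → ℤ} {q : ℕ → Fin 9}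
    (hq : IsLabelling t D q) {p : ℕ → ℕ} (hp : isNormalizer t s s' p = true) :
    IsLabelling t D (q ∘ p) ∧ ∀ I x, pointMask (q ∘ p) I x = permMask p (pointMask q I x) := by
  unfold isNormalizer at hp
  simp only [Bool.and_eq_true, List.all_eq_true, List.mem_range, Bool.or_eq_true, Bool.not_eq_true',
    Nat.beq_eq, Nat.blt_eq] at hp
  obtain ⟨⟨⟨hp, -⟩, -⟩, -⟩ := hp
  refine ⟨⟨fun i j hi hj hij => ?_, fun i hi w => ?_⟩, pointMask_comp (fun i hi => (hp i hi).1.1) q⟩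
  · refine ((hp i hi).2 j hj).resolve_right fun e => ?_
    rw [hq.inj _ _ (hp i hi).1.1 (hp j hj).1.1 hij] at e
    simp at e
  · simp only [Function.comp_apply]
    rw [hq.adj _ (hp i hi).1.1]
    rcases (hp i hi).1.2 with ⟨e1, e2⟩ | ⟨e1, e2⟩
    · rw [e1, e2]
    · rw [e1, e2, or_comm]

/-- For 3+3+3 every point will do; for 6+3, a point common to two opposite blocks of the hexagon. -/
theorem IsMasked.exists_triangle {t u R S T} (h : IsMasked t u R S T) (ht : t < 2) :
    ∃ x y z, y ≠ z ∧ R x y ∧ R x z ∧ R y z := by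
  interval_cases t
  · obtain ⟨y, z, hyz, hw⟩ := h.regular.exists_pair 0
    have hy := (hw y).2 (Or.inl rfl)
    have hz := (hw z).2 (Or.inr rfl)
    exact ⟨0, y, z, hyz, hy, hz, h.triangle_zero hyz hy hz⟩
  · have hex : (Finset.univ.filter fun x => (S x).testBit 0 = true ∧
        (S x).testBit 3 = true).Nonempty := by
      rw [← Finset.card_pos, h.left_pair (by norm_num) (by norm_num) (by norm_num)]
      decide
    obtain ⟨x, hx⟩ := hex
    have hx' := (Finset.mem_filter.1 hx).2
    have h1 : S x &&& 9 = 9 := and_eq_of_testBit hx'.1 hx'.2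
    obtain ⟨y, z, hyz, hw⟩ := h.regular.exists_pair x
    have hy := (hw y).2 (Or.inl rfl)
    have hz := (hw z).2 (Or.inr rfl)
    exact ⟨x, y, z, hyz, hy, hz, h.triangle_opposite (by simp [hexOpposite, h1]) hyz hy hz⟩

/-- A configuration can be labelled so that some triangle of points is in standard position. -/
theorem IsConfig.exists_based_labelling {κ D E I J} (h : IsConfig κ D E I J) :
    ∃ t, t < 2 ∧ ∃ q r, IsLabelling t D q ∧ IsLabelling t E r ∧
      ∀ v ∈ baseWords, ∃ x, pointMask q I x + 512 * pointMask r J x = v := by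
  obtain ⟨t, ht, q, hq⟩ := h.left.exists_labelling
  obtain ⟨u, hu, r, hr⟩ := h.right.exists_labelling
  have hm := h.isMasked ht hu hq hr
  obtain ⟨ht2, rfl⟩ : t < 2 ∧ u = t := by
    rcases hm.types ht hu with ⟨rfl, rfl⟩ | ⟨rfl, rfl⟩ <;> simp
  obtain ⟨x, y, z, hne, hxy, hxz, hyz⟩ := hm.exists_triangle ht2
  obtain ⟨hS, hSz⟩ := hm.isPerfect_left ht hne hxy hxz hyz
  have hxz' : x ≠ z := fun e => hm.regular.irrefl x (by rw [← e] at hxz; exact hxz)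
  have hyx := hm.regular.symm hxy
  obtain ⟨hS', -⟩ := hm.isPerfect_left ht hxz' hyx hyz hxz
  obtain ⟨hT', -⟩ := hm.swap.isPerfect_left ht hxz' hyx hyz hxz
  obtain ⟨hT, hTz⟩ := hm.swap.isPerfect_left ht hne hxy hxz hyz
  have nS := isNormalizer_normalizer ht2 (hm.left_mem x) (hm.left_mem y) hS hS'
  have nT := isNormalizer_normalizer ht2 (hm.right_mem x) (hm.right_mem y) hT hT'
  obtain ⟨hq', eq⟩ := hq.comp nS
  obtain ⟨hr', er⟩ := hr.comp nT
  refine ⟨u, ht2, _, _, hq', hr', ?_⟩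
  unfold isNormalizer at nS nT
  simp only [Bool.and_eq_true, Nat.beq_eq] at nS nT
  obtain ⟨⟨⟨-, a1⟩, a2⟩, a3⟩ := nS
  obtain ⟨⟨⟨-, b1⟩, b2⟩, b3⟩ := nT
  rw [← hSz] at a3
  rw [← hTz] at b3
  unfold baseWords
  simp only [List.mem_cons, List.not_mem_nil, or_false]
  rintro v (rfl | rfl | rfl)
  · exact ⟨x, by rw [eq, er, a1, b1]⟩
  · exact ⟨y, by rw [eq, er, a2, b2]⟩
  · exact ⟨z, by rw [eq, er, a3, b3]⟩

/-! ### Isomorphism with a standard graph -/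

theorem rowsGraph_adj {rows : List ℕ} (h : isSymmetric rows = true) (i j : Fin 36) :
    (rowsGraph rows).Adj i j ↔ (rows.getD i 0).testBit j = true := by
  unfold isSymmetric at h
  simp only [List.all_eq_true, List.mem_range, Bool.and_eq_true, Bool.not_eq_true',
    beq_iff_eq] at h
  unfold rowsGraph
  rw [SimpleGraph.fromRel_adj, (h i i.2).2 j j.2, or_self]
  refine ⟨fun h' => h'.2, fun h' => ⟨?_, h'⟩⟩
  rintro rfl
  rw [(h i i.2).1] at h'
  simp at h'

/-- Points joined in κ satisfy `pointAdj`, the third word being that of the other neighbour. Since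
κ-degrees are 2, a word with fewer than two partners is impossible, and if all words have exactly
two partners, then the relations coincide. -/
theorem IsMasked.pointAdj_iff {t R S T} (h : IsMasked t t R S T) (ht : t < 2) {l : List ℕ}
    (hl : IsListing (fun x => S x + 512 * T x) l) (he : isExpected t l = true) :
    (∀ x y, R x y ↔ pointAdj t l (S x + 512 * T x) (S y + 512 * T y) = true) ∧
      ∃ p, isIsomorphism t l (standardRows t) p = true := by
  classical
  have hlt := h.left_lt (by omega)
  have hmod : ∀ x, (S x + 512 * T x) % 512 = S x := fun x => by have := hlt x; omega
  have hdiv : ∀ x, (S x + 512 * T x) / 512 = T x := fun x => by have := hlt x; omega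
  have hadj : ∀ x y, R x y → pointAdj t l (S x + 512 * T x) (S y + 512 * T y) = true := by
    intro x y hxy
    obtain ⟨z, hyz, hxz⟩ := h.exists_third hxy
    obtain ⟨h1, h2⟩ := h.left_step hyz hxy hxz
    obtain ⟨h3, h4⟩ := h.right_step hyz hxy hxz
    unfold pointAdj
    rw [hmod, hmod, hdiv, hdiv, h2, h4, ← h1, ← h3, Bool.and_true, Bool.true_and, List.any_eq_true]
    exact ⟨_, hl.2.2 z, by simp⟩
  have hcount : ∀ x, (Finset.univ.filter fun y =>
      pointAdj t l (S x + 512 * T x) (S y + 512 * T y) = true).card =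
        l.countP (pointAdj t l (S x + 512 * T x)) := by
    intro x
    rw [← card_filter_mem (h.word_injective (by omega)) hl.1 hl.2.1]
    congr 1
    exact Finset.filter_congr fun y _ => by simp only [hl.2.2 y, true_and]
  have hsub : ∀ x, (Finset.univ.filter fun y => R x y) ⊆ Finset.univ.filter fun y =>
      pointAdj t l (S x + 512 * T x) (S y + 512 * T y) = true :=
    fun x => Finset.monotone_filter_right _ fun y _ hy => hadj x y hy
  have htwo : ∀ x, (Finset.univ.filter fun y => R x y).card = 2 := by
    intro x
    obtain ⟨y, z, hyz, hw⟩ := h.regular.exists_pair x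
    rw [← Finset.card_pair hyz]
    congr 1
    ext w
    simp [hw]
  unfold isExpected at he
  simp only [Bool.and_eq_true, Bool.or_eq_true, List.any_eq_true, List.all_eq_true, Nat.blt_eq,
    Nat.beq_eq] at he
  rcases he.2 with ⟨v, hv, hlt2⟩ | ⟨hall, p, -, hp⟩
  · obtain ⟨x, rfl⟩ := hl.2.1 v hv
    have := Finset.card_le_card (hsub x)
    rw [hcount, htwo] at this
    exact absurd this (not_le.2 hlt2)
  · refine ⟨fun x y => ⟨hadj x y, fun hxy => ?_⟩, p, hp⟩
    have he := Finset.eq_of_subset_of_card_le (hsub x)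
      (by rw [hcount, htwo, hall _ (hl.2.2 x)])
    have : y ∈ Finset.univ.filter fun y => R x y := by rw [he]; simpa using hxy
    simpa using this

theorem IsListing.length_eq {w : Fin 18 → ℕ} (hw : Function.Injective w) {l : List ℕ}
    (hl : IsListing w l) : l.length = 18 := by
  have h := card_filter_mem hw hl.1 hl.2.1 fun _ => true
  simpa [hl.2.2] using h.symm

/-- The vertex with the given number, see `codeAdj`. -/
def codeVertex (pt : ℕ → Fin 18) (q r : ℕ → Fin 9) (i : Fin 36) : Vertex :=
  if i.1 < 18 then .inl (pt i) else if i.1 < 27 then .inr (.inr (q (i - 18)))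
  else .inr (.inl (r (i - 27)))

theorem codeVertex_injective {pt : ℕ → Fin 18} {q r : ℕ → Fin 9}
    (hpt : ∀ i j, i < 18 → j < 18 → pt i = pt j → i = j)
    (hq : ∀ i j, i < 9 → j < 9 → q i = q j → i = j)
    (hr : ∀ i j, i < 9 → j < 9 → r i = r j → i = j) :
    Function.Injective (codeVertex pt q r) := by
  intro i j hij
  have hi := i.2
  have hj := j.2
  apply Fin.ext
  unfold codeVertex at hij
  split_ifs at hij
  · exact hpt _ _ (by omega) (by omega) (Sum.inl.inj hij)
  · have := hq _ _ (by omega) (by omega) (Sum.inr.inj (Sum.inr.inj hij))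
    omega
  · cases hij
  · cases hij
  · have := hr _ _ (by omega) (by omega) (Sum.inl.inj (Sum.inr.inj hij))
    omega

/-- The standard graphs are the only ones, up to isomorphism. -/
theorem SimpleGraph.IsQuadratic.exists_iso {H : SimpleGraph Vertex} (h : H.IsQuadratic) :
    ∃ t, t < 2 ∧ Nonempty (H ≃g rowsGraph (standardRows t)) := by
  have hc := h.isConfig
  obtain ⟨t, ht, q, r, hq, hr, hb⟩ := hc.exists_based_labelling
  have hm := hc.isMasked (by omega) (by omega) hq hr
  obtain ⟨l, he, hl⟩ := hm.exists_listing ht hb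
  obtain ⟨hR, p, hp⟩ := hm.pointAdj_iff ht hl he
  have hlt := hm.left_lt (by omega)
  have hlen := hl.length_eq (hm.word_injective (by omega))
  set I : Fin 9 → Fin 18 → ℤ := fun y x => H.ind (.inr (.inr y)) (.inl x) with hI
  set J : Fin 9 → Fin 18 → ℤ := fun y x => 1 - H.ind (.inr (.inl y)) (.inl x) with hJ
  have hpt : ∀ i, ∃ x, i < 18 → pointMask q I x + 512 * pointMask r J x = l.getD i 0 := by
    intro i
    by_cases hi : i < 18
    · obtain ⟨x, hx⟩ := hl.2.1 (l.getD i 0) (by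
        rw [List.getD_eq_getElem _ _ (by omega)]; exact List.getElem_mem _)
      exact ⟨x, fun _ => hx⟩
    · exact ⟨0, fun h => absurd h hi⟩
  choose pt hpt using hpt
  have hinj : ∀ i j, i < 18 → j < 18 → pt i = pt j → i = j := by
    intro i j hi hj hij
    have h1 : l.getD i 0 = l.getD j 0 := by rw [← hpt i hi, ← hpt j hj, hij]
    rw [List.getD_eq_getElem _ _ (by omega), List.getD_eq_getElem _ _ (by omega)] at h1
    exact (hl.1.getElem_inj_iff).1 h1
  have hginj := codeVertex_injective hinj hq.inj hr.inj
  have pp : ∀ i j, i < 18 → j < 18 → (H.Adj (.inl (pt i)) (.inl (pt j)) ↔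
      i ≠ j ∧ pointAdj t l (l.getD i 0) (l.getD j 0) = false) := by
    intro i j hi hj
    rw [← hpt i hi, ← hpt j hj, ← Bool.not_eq_true, ← hR]
    by_cases hij : i = j
    · subst hij; simp
    · have hne : pt i ≠ pt j := fun e => hij (hinj i j hi hj e)
      rw [← H.ind_eq_one]
      simp only [ne_eq, hij, not_false_eq_true, true_and, SimpleGraph.coind, if_neg hne]
      rcases H.ind_zero_or_one (.inl (pt i)) (.inl (pt j)) with e | e <;> simp [e]
  have cp : ∀ i k, i < 18 → k < 9 → (H.Adj (.inr (.inr (q k))) (.inl (pt i)) ↔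
      (l.getD i 0).testBit k = true) := by
    intro i k hi hk
    rw [← hpt i hi, testBit_word (hlt _), if_pos hk, testBit_pointMask, ← H.ind_eq_one]
    simp [hk, hI]
  have bp : ∀ i k, i < 18 → k < 9 → (H.Adj (.inr (.inl (r k))) (.inl (pt i)) ↔
      (l.getD i 0).testBit (k + 9) = false) := by
    intro i k hi hk
    rw [← hpt i hi, testBit_word (hlt _), if_neg (by omega), Nat.add_sub_cancel, testBit_pointMask,
      ← H.ind_eq_one]
    rcases H.ind_zero_or_one (.inr (.inl (r k))) (.inl (pt i)) with e | e <;> simp [e, hk, hJ]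
  have cc : ∀ j k, j < 9 → k < 9 → (H.Adj (.inr (.inr (q j))) (.inr (.inr (q k))) ↔
      cycleAdj t j k = 1) := by
    intro j k hj hk
    rw [← H.ind_eq_one, ← Nat.cast_inj (R := ℤ),
      ← IsHalf.graph_eq hq hc.left.graph_zero_or_one (by omega) hj hk, Nat.cast_one]
  have bb : ∀ j k, j < 9 → k < 9 → (H.Adj (.inr (.inl (r j))) (.inr (.inl (r k))) ↔
      cycleAdj t j k = 1) := by
    intro j k hj hk
    rw [← H.ind_eq_one, ← Nat.cast_inj (R := ℤ),
      ← IsHalf.graph_eq hr hc.right.graph_zero_or_one (by omega) hj hk, Nat.cast_one]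
  have bc : ∀ b c, ¬ H.Adj (.inr (.inl b)) (.inr (.inr c)) := by
    intro b c hbc
    have := h.no_edge b c
    rw [(H.ind_eq_one _ _).2 hbc] at this
    exact absurd this (by norm_num)
  have hadj : ∀ i j : Fin 36, H.Adj (codeVertex pt q r i) (codeVertex pt q r j) ↔
      codeAdj t l i j = true := by
    intro i j
    have hi := i.2
    have hj := j.2
    have hblt : ∀ a b, Nat.blt a b = decide (a < b) := fun a b => by
      rw [Bool.eq_iff_iff, Nat.blt_eq, decide_eq_true_iff]
    unfold codeVertex codeAdj
    simp only [hblt]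
    by_cases i18 : i.1 < 18
    · simp only [i18, if_true, decide_true, cond_true]
      by_cases j18 : j.1 < 18
      · simp only [j18, if_true, decide_true, cond_true]
        rw [pp _ _ i18 j18, Bool.and_eq_true, Bool.not_eq_true', Bool.not_eq_true',
          ← Bool.not_eq_true (Nat.beq _ _), Nat.beq_eq]
      by_cases j27 : j.1 < 27
      · simp only [j18, j27, if_true, if_false, decide_true, decide_false, cond_true, cond_false]
        rw [H.adj_comm, cp _ _ i18 (by omega)]
      · simp only [j18, j27, if_false, decide_false, cond_false]
        rw [H.adj_comm, bp _ _ i18 (by omega), show j.1 - 27 + 9 = j.1 - 18 by omega]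
        simp
    by_cases i27 : i.1 < 27
    · simp only [i18, i27, if_true, if_false, decide_true, decide_false, cond_true, cond_false]
      by_cases j18 : j.1 < 18
      · simp only [j18, if_true, decide_true, cond_true]
        rw [cp _ _ j18 (by omega)]
      by_cases j27 : j.1 < 27
      · simp only [j18, j27, if_true, if_false, decide_true, decide_false, cond_false]
        rw [cc _ _ (by omega) (by omega)]
        simp
      · simp only [j18, j27, if_false, decide_false, cond_false, Bool.false_and]
        rw [H.adj_comm]
        simp [bc]
    · simp only [i18, i27, if_false, decide_false, cond_false]
      by_cases j18 : j.1 < 18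
      · simp only [j18, if_true, decide_true, cond_true]
        rw [bp _ _ j18 (by omega), show i.1 - 27 + 9 = i.1 - 18 by omega]
        simp
      by_cases j27 : j.1 < 27
      · simp only [j18, j27, if_true, if_false, decide_true, decide_false, cond_false]
        simp [bc]
      · simp only [j18, j27, if_false, decide_false, cond_false]
        rw [bb _ _ (by omega) (by omega)]
        simp
  unfold isIsomorphism at hp
  simp only [List.all_eq_true, List.mem_range, Bool.and_eq_true, Bool.or_eq_true, Nat.blt_eq,
    Nat.beq_eq, Bool.not_eq_true', beq_iff_eq] at hp
  let f : Fin 36 → Fin 36 := fun i => ⟨p.getD i 0, (hp i i.2).1⟩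
  have hf : Function.Injective f := by
    intro i j hij
    have h1 : p.getD i 0 = p.getD j 0 := congrArg Fin.val hij
    refine Fin.ext ((((hp i i.2).2 j j.2).1).resolve_right fun e => ?_)
    rw [h1] at e
    simp at e
  let g : Fin 36 ≃ Vertex := Equiv.ofBijective _ ((Fintype.bijective_iff_injective_and_card _).2
    ⟨hginj, by simp [Vertex]⟩)
  let e : Fin 36 ≃ Fin 36 := Equiv.ofBijective f (Finite.injective_iff_bijective.1 hf)
  refine ⟨t, ht, ⟨⟨g.symm.trans e, ?_⟩⟩⟩
  intro a b
  obtain ⟨i, rfl⟩ := g.surjective a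
  obtain ⟨j, rfl⟩ := g.surjective b
  simp only [Equiv.trans_apply, Equiv.symm_apply_apply]
  rw [rowsGraph_adj (isSymmetric_standardRows t ht)]
  change _ ↔ H.Adj (codeVertex pt q r i) (codeVertex pt q r j)
  rw [hadj, ← ((hp i i.2).2 j j.2).2]
  rfl

/-! ### The two graphs have the required properties and are not isomorphic -/

/-- The entries of the adjacency matrices of the standard graphs. -/
def entry (t : ℕ) (i j : Fin 36) : ℕ := (((standardRows t).getD i 0).testBit j).toNat

/-- The Perron weights of the standard graphs. -/
def entryWeight (i : Fin 36) : ℕ := if i.1 < 18 then 3 else if i.1 < 27 then 1 else 2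

theorem sum_entry_mul (t : ℕ) (ht : t < 2) (i j : Fin 36) :
    ∑ k, entry t i k * entry t k j + entry t i j =
      (if i = j then 6 else 0) + 2 * (entryWeight i * entryWeight j) := by
  revert i j
  interval_cases t <;> decide +kernel

theorem sum_entry_mul_weight (t : ℕ) (ht : t < 2) (i : Fin 36) :
    ∑ k, entry t i k * entryWeight k = 20 * entryWeight i := by
  revert i
  interval_cases t <;> decide +kernel

theorem sum_entry (t : ℕ) (ht : t < 2) (i : Fin 36) :
    ∑ k, entry t i k = 6 + 2 * (entryWeight i * entryWeight i) := by
  revert i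
  interval_cases t <;> decide +kernel

theorem entry_eq {t : ℕ} (ht : t < 2) (i j : Fin 36)
    [Decidable ((rowsGraph (standardRows t)).Adj i j)] :
    entry t i j = if (rowsGraph (standardRows t)).Adj i j then 1 else 0 := by
  unfold entry
  simp only [rowsGraph_adj (isSymmetric_standardRows t ht)]
  cases ((standardRows t).getD i 0).testBit j <;> simp

theorem entry_eq_one_iff {t : ℕ} (ht : t < 2) (i j : Fin 36) :
    entry t i j = 1 ↔ (rowsGraph (standardRows t)).Adj i j := by
  classical
  rw [entry_eq ht]
  split_ifs <;> simp [*]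

theorem degree_standard {t : ℕ} (ht : t < 2) (i : Fin 36)
    [Fintype ((rowsGraph (standardRows t)).neighborSet i)] :
    (rowsGraph (standardRows t)).degree i = 6 + 2 * (entryWeight i * entryWeight i) := by
  classical
  rw [← sum_entry t ht, Finset.sum_congr rfl fun j _ => entry_eq ht i j, ← Finset.card_filter,
    ← SimpleGraph.card_neighborSet_eq_degree]
  exact Fintype.card_of_subtype _ fun j => by simp

theorem hasPrescribedArrayAndSpectrum_standard {t : ℕ} (ht : t < 2) :
    (rowsGraph (standardRows t)).HasPrescribedArrayAndSpectrum := by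
  classical
  have hval : (rowsGraph (standardRows t)).valencies = [24, 14, 8] := by
    unfold SimpleGraph.valencies
    simp only [degree_standard ht]
    rw [show (Finset.univ.image fun v => 6 + 2 * (entryWeight v * entryWeight v)) =
      [24, 14, 8].toFinset by decide +kernel, List.toFinset_sort _ (by decide)]
    decide
  constructor
  · unfold SimpleGraph.valencyArray
    simp only [hval, degree_standard ht]
    rw [Prod.mk.injEq]
    refine ⟨?_, rfl⟩
    simp only [List.map_cons, List.map_nil]
    decide +kernel
  · unfold SimpleGraph.adjSpectrum
    have hA : ∀ i j, (rowsGraph (standardRows t)).adjMatrix ℝ i j = entry t i j := by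
      intro i j
      rw [SimpleGraph.adjMatrix_apply, entry_eq ht]
      push_cast
      rfl
    have hquad : ∀ i j, ((rowsGraph (standardRows t)).adjMatrix ℝ *
        (rowsGraph (standardRows t)).adjMatrix ℝ + (rowsGraph (standardRows t)).adjMatrix ℝ) i j =
        (if i = j then 6 else 0) + 2 * ((entryWeight i : ℝ) * entryWeight j) := by
      intro i j
      rw [Matrix.add_apply, Matrix.mul_apply]
      simp only [hA]
      exact_mod_cast congrArg (Nat.cast (R := ℝ)) (sum_entry_mul t ht i j)
    have hdiag : ∀ i, ((rowsGraph (standardRows t)).adjMatrix ℝ *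
        (rowsGraph (standardRows t)).adjMatrix ℝ) i i = (6 + 2 * (entryWeight i * entryWeight i) : ℕ) := by
      intro i
      have := hquad i i
      rw [Matrix.add_apply, SimpleGraph.adjMatrix_apply, if_neg (SimpleGraph.irrefl _), add_zero,
        if_pos rfl] at this
      rw [this]
      push_cast
      rfl
    convert Matrix.IsHermitian.roots_of_rank_one ?_ (fun i => (entryWeight i : ℝ)) hquad ?_ ?_ ?_ ?_
    · unfold Matrix.IsHermitian
      rw [Matrix.conjTranspose_eq_transpose_of_trivial, SimpleGraph.transpose_adjMatrix]
    · ext i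
      simp only [Matrix.mulVec, dotProduct, hA, Pi.smul_apply, smul_eq_mul]
      exact_mod_cast congrArg (Nat.cast (R := ℝ)) (sum_entry_mul_weight t ht i)
    · simp
    · exact SimpleGraph.trace_adjMatrix _ _
    · unfold Matrix.trace
      simp only [Matrix.diag_apply, hdiag]
      -- The sum of the degrees is 18·24 + 9·14 + 9·8 = 630.
      rw [← Nat.cast_sum, show ∑ i, (6 + 2 * (entryWeight i * entryWeight i)) = 630 by decide +kernel]
      norm_num

/-- In the first graph, but not in the second one, all vertices of degree `8` lie in triangles of such
vertices. -/
theorem isEmpty_standard_iso :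
    IsEmpty (rowsGraph (standardRows 0) ≃g rowsGraph (standardRows 1)) := by
  classical
  refine ⟨fun φ => ?_⟩
  have h0 : ∀ v : Fin 36, entryWeight v = 1 → ∃ a b, entryWeight a = 1 ∧ entryWeight b = 1 ∧
      entry 0 v a = 1 ∧ entry 0 v b = 1 ∧ entry 0 a b = 1 := by
    decide +kernel
  -- In the second graph vertex 18 has degree 8 and lies on the hexagon, so its two neighbours of
  -- degree 8 are not adjacent.
  have h1 : ∀ a b : Fin 36, entryWeight a = 1 → entryWeight b = 1 →
      entry 1 18 a = 1 → entry 1 18 b = 1 → entry 1 a b = 1 → False := by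
    decide +kernel
  have hw : ∀ v, entryWeight (φ v) = entryWeight v := by
    intro v
    have h := φ.degree_eq v
    rw [degree_standard (by norm_num), degree_standard (by norm_num)] at h
    nlinarith
  have hadj : ∀ a b, entry 0 a b = 1 → entry 1 (φ a) (φ b) = 1 := by
    intro a b h
    rw [entry_eq_one_iff (by norm_num)] at h ⊢
    exact φ.map_rel_iff.2 h
  obtain ⟨v, hv⟩ := φ.surjective 18
  obtain ⟨a, b, ha, hb, hva, hvb, hab⟩ := h0 v (by rw [← hw, hv]; rfl)
  exact h1 (φ a) (φ b) (by rw [hw, ha]) (by rw [hw, hb]) (hv ▸ hadj _ _ hva) (hv ▸ hadj _ _ hvb)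
    (hadj _ _ hab)

theorem theorem7p3 :
    ∃ G₁ G₂ : SimpleGraph (Fin 36),
      G₁.HasPrescribedArrayAndSpectrum ∧ G₂.HasPrescribedArrayAndSpectrum ∧
      IsEmpty (G₁ ≃g G₂) ∧
      ∀ (V : Type*) [Fintype V] (G : SimpleGraph V), G.HasPrescribedArrayAndSpectrum →
        Nonempty (G ≃g G₁) ∨ Nonempty (G ≃g G₂) := by
  refine ⟨rowsGraph (standardRows 0), rowsGraph (standardRows 1),
    hasPrescribedArrayAndSpectrum_standard (by norm_num),
    hasPrescribedArrayAndSpectrum_standard (by norm_num), isEmpty_standard_iso, ?_⟩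
  intro V _ G hG
  obtain ⟨H, hH, ⟨e⟩⟩ := hG.exists_isQuadratic
  obtain ⟨t, ht, ⟨e'⟩⟩ := hH.exists_iso
  interval_cases t
  · exact Or.inl ⟨e.trans e'⟩
  · exact Or.inr ⟨e.trans e'⟩
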